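/- Let $\mathcal W_1$ be the family of bounded nonempty open convex sets $\Omega\subset\mathbb R^2$ of constant width $1$, i.e. such that $h_\Omega(\xi)+h_\Omega(-\xi)=1$ for every unit vector $\xi$, where $h_\Omega(\xi)=\sup_{x\in\Omega}x\cdot\xi$ is the support function. For $\Omega\in\mathcal W_1$ write $h_\Omega(\theta)$ for $h_\Omega(\cos\theta,\sin\theta)$ and let $r_\Omega=h_\Omega+h_\Omega''$ be the curvature function (defined for a.e. angle $\theta$). For $x\in\partial\Omega$ let $\nu_\Omega(x)$ be the set of outer unit normals of $\Omega$ at $x$, and call $y\in\partial\Omega$ diametral to $x$ if $|x-y|=\operatorname{diam}\Omega$; let $D(x)$ be the set of points diametral to $x$ (a single point if $\nu_\Omega(x)$ is a singleton). Let $\Omega\in\mathcal W_1$ and let $\xi_0=(\cos\theta_0,\sin\theta_0)$ be a Lebesgue point of $r_\Omega$ with value $0$, that is, $\frac1{2\delta}\int_{\theta_0-\delta}^{\theta_0+\delta}|r_\Omega(t)|\,dt\to0$ as $\delta\to0^+$. Let $x_0\in\partial\Omega$ be such that $\xi_0\in\nu_\Omega(x_0)$, and let $x_1\in D(x_0)$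 be a diametral point of $x_0$. Then there are $\varepsilon_0>0$ and a family $(\Omega_\varepsilon)_{0<\varepsilon<\varepsilon_0}$ of sets in $\mathcal W_1$ such that: 1. for every $\varepsilon\in(0,\varepsilon_0)$, $x_0\in\overline{\Omega\setminus\Omega_\varepsilon}$ and $x_1\in\overline{\Omega_\varepsilon\setminus\Omega}$; 2. for every $\delta>0$ and all sufficiently small $\varepsilon>0$, $\Omega\setminus\Omega_\varepsilon$ is contained in the ball of radius $\delta$ about $x_0$, and $\Omega_\varepsilon\setminus\Omega$ is contained in the open $\delta$-neighbourhood of $D(x_0)$ (the ball of radius $\delta$ about $x_1$, if $x_1$ is the only diametral point of $x_0$); 3. $|\Omega\setminus\Omega_\varepsilon|\to0$ and $|\Omega_\varepsilon\setminus\Omega|\to0$ as $\varepsilon\to0^+$; 4. $|\Omega\setminus\Omega_\varepsilon|>0$ for every $\varepsilon\in(0,\varepsilon_0)$, and $$\lim_{\varepsilon\to0^+}\frac{|\Omega_\varepsilon\setminus\Omega|}{|\Omega\setminus\Omega_\varepsilon|}=+\infty .$$ In particular, $|\Omega_\varepsilon|>|\Omega|$ for all sufficiently small $\varepsilon>0$.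 -/

import Mathlib

open Set Filter Topology MeasureTheory

noncomputable section

/-- The Euclidean plane. -/
abbrev Plane : Type := EuclideanSpace ℝ (Fin 2)

/-- The unit vector `(cos θ, sin θ)`. -/
def dir (θ : ℝ) : Plane := !₂[Real.cos θ, Real.sin θ]

/-- The support function `h_Ω(ξ) = sup_{x ∈ Ω} x · ξ`. -/
def supportFn (Ω : Set Plane) (ξ : Plane) : ℝ :=
  sSup ((fun x : Plane => inner ℝ x ξ) '' Ω)

/-- The class `𝒲₁`: (nonempty, bounded) open convex sets of the plane whose width in every
direction equals `1`. -/
structure ConstantWidthOne (Ω : Set Plane) : Prop where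
  isOpen : IsOpen Ω
  convex : Convex ℝ Ω
  nonempty : Ω.Nonempty
  isBounded : Bornology.IsBounded Ω
  width_eq : ∀ ξ : Plane, ‖ξ‖ = 1 → supportFn Ω ξ + supportFn Ω (-ξ) = 1

/-- The curvature function `r_Ω = h_Ω + h_Ω''` (the radius of curvature), as a function of the
angle `θ` of the direction `(cos θ, sin θ)`. For a set of constant width `h_Ω` is of class
`C^{1,1}`, so that the second derivative exists for almost every angle. -/
def curvatureFn (Ω : Set Plane) (θ : ℝ) : ℝ :=
  supportFn Ω (dir θ) + deriv (deriv fun t => supportFn Ω (dir t)) θ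

/-- `t` is a Lebesgue point of `f`, and the approximate limit of `f` at `t` is `a`: the mean of
`|f - a|` over `[t - δ, t + δ]` tends to `0` as `δ → 0⁺`. -/
def HasLebesgueValue (f : ℝ → ℝ) (t a : ℝ) : Prop :=
  Tendsto (fun δ : ℝ => ⨍⁻ s in Icc (t - δ) (t + δ), ‖f s - a‖ₑ ∂volume) (𝓝[>] 0) (𝓝 0)

/-- The (multivalued) Gauss map: the set of outer unit normals of a convex set `Ω` at `x`. -/
def gaussMap (Ω : Set Plane) (x : Plane) : Set Plane :=
  {ξ | ‖ξ‖ = 1 ∧ ∀ y ∈ Ω, inner ℝ (y - x) ξ ≤ 0}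

/-- The points that are diametral to `x` in `Ω`: those `y` for which `x` and `y` are the
extrema of a diameter of `Ω`. -/
def diametralPoints (Ω : Set Plane) (x : Plane) : Set Plane :=
  {y | x ∈ frontier Ω ∧ y ∈ frontier Ω ∧ dist x y = Metric.diam Ω}

end

/-! Write `ξ₀ = dir θ₀` and let `y = x₀ - (1 + ε) • ξ₀`, a point at distance `ε` beyond the point
`x₀ - ξ₀` opposite to `x₀`. Keeping only the part of `closure Ω` in the open unit disc about `y` and
adding `y` gives a set of diameter at most `1`. By Zorn's lemma it lies in a diametrically complete
set `M ε`, and `Ωε` is the interior of `M ε`. The completion is not explicit. All estimates use only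
that it is complete and contains `y` and the truncated set.

In the plane, complete sets and sets of constant width are the same thing. The key is
`IsDiamComplete.sub_normal_mem`: if `ξ` is an outer normal at `x`, then `x - ξ` belongs to the set.
The other direction is `ConstantWidthOne.isDiamComplete_closure`.

The Lebesgue point condition says that the boundary point `X θ` with normal `dir θ` satisfies `X (θ₀
+ t) - X θ₀ = o(t)` (`IsNormalParam.exists_norm_sub_le`), so that `∂Ω` is nearly a corner at `x₀`.
The lost cap then has depth `O(ε)` and width only `o(√ε)`, hence area `o(ε^{3/2})`
(`eventually_cap_bound`). Opposite to `x₀` the boundary is nearly a unit arc, so the convex hull of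
`y` and the kept part gains a region of height about `ε` and width about `√ε`, of area at least
`ε^{3/2} / 32` (`eventually_rectangle_subset`). The ratio of the areas therefore diverges.

Localization of the gain is a compactness argument (`eventually_gain_subset_thickening`). That every
diametral point is reached (`mem_closure_gain`) follows by excluding a common normal of `Ω` and `M
ε` there or at nearby points of the unit arc about `x₀`. -/

/-! ### Planar linear algebra -/

/-- Rotation of a plane vector by a right angle. -/
def rotQuarter (v : Plane) : Plane := !₂[-v 1, v 0]

lemma inner_plane (v w : Plane) : inner ℝ v w = v 0 * w 0 + v 1 * w 1 := by
  simp [PiLp.inner_apply, Fin.sum_univ_two]; ring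

lemma norm_sq_plane (v : Plane) : ‖v‖ ^ 2 = v 0 ^ 2 + v 1 ^ 2 := by
  rw [EuclideanSpace.norm_sq_eq]; simp [Fin.sum_univ_two]

lemma norm_rotQuarter (v : Plane) : ‖rotQuarter v‖ = ‖v‖ := by
  have h : ‖rotQuarter v‖ ^ 2 = ‖v‖ ^ 2 := by
    rw [norm_sq_plane, norm_sq_plane]; simp [rotQuarter]; ring
  exact (sq_eq_sq₀ (norm_nonneg _) (norm_nonneg _)).1 h

lemma inner_rotQuarter_self (v : Plane) : inner ℝ (rotQuarter v) v = 0 := by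
  rw [inner_plane]; simp [rotQuarter]; ring

lemma inner_self_rotQuarter (v : Plane) : inner ℝ v (rotQuarter v) = 0 := by
  rw [inner_plane]; simp [rotQuarter]; ring

/-- The inner product in the orthonormal frame `ξ`, `rotQuarter ξ`. -/
lemma inner_eq_frame {ξ : Plane} (hξ : ‖ξ‖ = 1) (v w : Plane) :
    inner ℝ v w = inner ℝ v ξ * inner ℝ w ξ
      + inner ℝ v (rotQuarter ξ) * inner ℝ w (rotQuarter ξ) := by
  have h : ξ 0 ^ 2 + ξ 1 ^ 2 = 1 := by rw [← norm_sq_plane, hξ]; norm_num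
  simp only [inner_plane]
  simp only [rotQuarter, PiLp.toLp_apply, Matrix.cons_val_zero, Matrix.cons_val_one]
  linear_combination (-(v 0 * w 0 + v 1 * w 1)) * h

lemma norm_sq_eq_frame {ξ : Plane} (hξ : ‖ξ‖ = 1) (v : Plane) :
    ‖v‖ ^ 2 = inner ℝ v ξ ^ 2 + inner ℝ v (rotQuarter ξ) ^ 2 := by
  rw [← real_inner_self_eq_norm_sq, inner_eq_frame hξ]; ring

/-- This is the form in which most bounds on distances are used: they become linear in the unit
vector `ξ`, so they can be combined for several centres. -/
lemma norm_add_le_one_iff {ξ : Plane} (hξ : ‖ξ‖ = 1) (w : Plane) :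
    ‖w + ξ‖ ≤ 1 ↔ ‖w‖ ^ 2 + 2 * inner ℝ w ξ ≤ 0 := by
  rw [← sq_le_one_iff₀ (norm_nonneg _), norm_add_sq_real, hξ]
  constructor <;> intro h <;> linarith

/-- Separation of a point from an open convex set by a unit vector. -/
lemma exists_unit_normal_of_notMem {U : Set Plane} (hU : IsOpen U) (hc : Convex ℝ U)
    (hne : U.Nonempty) {p : Plane} (hp : p ∉ U) :
    ∃ ζ : Plane, ‖ζ‖ = 1 ∧ ∀ z ∈ closure U, inner ℝ (z - p) ζ ≤ 0 := by
  obtain ⟨f, hf⟩ := geometric_hahn_banach_open_point hc hU hp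
  set v := (InnerProductSpace.toDual ℝ Plane).symm f with hv
  have hfv : ∀ z, f z = inner ℝ z v := fun z => by
    rw [real_inner_comm, hv, InnerProductSpace.toDual_symm_apply]
  have hv0 : v ≠ 0 := by
    rintro h0
    obtain ⟨z, hz⟩ := hne
    have := hf z hz
    rw [hfv, hfv, h0] at this
    simp at this
  refine ⟨(‖v‖)⁻¹ • v, norm_smul_inv_norm hv0, ?_⟩
  have hcl : closure U ⊆ {z | inner ℝ (z - p) ((‖v‖)⁻¹ • v) ≤ 0} := by
    refine closure_minimal ?_ (isClosed_le (by fun_prop) continuous_const)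
    intro z hz
    have := hf z hz
    rw [hfv, hfv] at this
    simp only [mem_ofPred_eq, inner_smul_right, inner_sub_left]
    have h2 : 0 < ‖v‖⁻¹ := by positivity
    nlinarith
  exact fun z hz => hcl hz

/-- Strict separation of a point from a closed convex set by a unit vector. -/
lemma exists_unit_normal_of_notMem_isClosed {C : Set Plane} (hC : IsClosed C) (hc : Convex ℝ C)
    (hne : C.Nonempty) {p : Plane} (hp : p ∉ C) :
    ∃ ζ : Plane, ‖ζ‖ = 1 ∧ ∀ z ∈ C, inner ℝ (z - p) ζ < 0 := by
  obtain ⟨f, u, hf, hu⟩ := geometric_hahn_banach_closed_point hc hC hp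
  set v := (InnerProductSpace.toDual ℝ Plane).symm f with hv
  have hfv : ∀ z, f z = inner ℝ z v := fun z => by
    rw [real_inner_comm, hv, InnerProductSpace.toDual_symm_apply]
  have hv0 : v ≠ 0 := by
    rintro h0
    obtain ⟨z, hz⟩ := hne
    have := (hf z hz).trans hu
    rw [hfv, hfv, h0] at this
    simp at this
  refine ⟨(‖v‖)⁻¹ • v, norm_smul_inv_norm hv0, fun z hz => ?_⟩
  have := (hf z hz).trans hu
  rw [hfv, hfv] at this
  simp only [inner_smul_right, inner_sub_left]
  have h2 : 0 < ‖v‖⁻¹ := by positivity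
  nlinarith

/-! ### Diametrically complete sets -/

/-- A set of the plane is diametrically complete (of diameter `1`) if it consists of exactly
those points whose distance to all of its points is at most `1`. -/
def IsDiamComplete (M : Set Plane) : Prop := ∀ x, x ∈ M ↔ ∀ z ∈ M, dist x z ≤ 1

namespace IsDiamComplete

variable {M : Set Plane}

lemma dist_le (hM : IsDiamComplete M) {x z : Plane} (hx : x ∈ M) (hz : z ∈ M) :
    dist x z ≤ 1 := (hM x).1 hx z hz

lemma nonempty (hM : IsDiamComplete M) : M.Nonempty := by
  by_contra h
  rw [not_nonempty_iff_eq_empty] at h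
  have := (hM 0).2 (by simp [h])
  simp [h] at this

lemma eq_iInter (hM : IsDiamComplete M) : M = ⋂ z ∈ M, Metric.closedBall z 1 := by
  ext x
  rw [hM x]
  simp

lemma isClosed (hM : IsDiamComplete M) : IsClosed M := by
  rw [hM.eq_iInter]
  exact isClosed_biInter fun z _ => Metric.isClosed_closedBall

lemma convex (hM : IsDiamComplete M) : Convex ℝ M := by
  rw [hM.eq_iInter]
  exact convex_iInter₂ fun z _ => convex_closedBall z 1

lemma isBounded (hM : IsDiamComplete M) : Bornology.IsBounded M := by
  obtain ⟨z, hz⟩ := hM.nonempty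
  exact Metric.isBounded_closedBall.subset fun x hx => Metric.mem_closedBall.2 (hM.dist_le hx hz)

lemma isCompact (hM : IsDiamComplete M) : IsCompact M :=
  Metric.isCompact_of_isClosed_isBounded hM.isClosed hM.isBounded

/-- Every set of diameter at most `1` is contained in a diametrically complete set. -/
theorem exists_superset {S : Set Plane} (hS : ∀ x ∈ S, ∀ z ∈ S, dist x z ≤ 1) :
    ∃ M, S ⊆ M ∧ IsDiamComplete M := by
  obtain ⟨M, hSM, hM⟩ := zorn_subset_nonempty
    {T : Set Plane | ∀ x ∈ T, ∀ z ∈ T, dist x z ≤ 1} (by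
      intro c hc hchain _
      refine ⟨⋃₀ c, ?_, fun s hs => subset_sUnion_of_mem hs⟩
      rintro x ⟨s, hs, hxs⟩ z ⟨t, ht, hzt⟩
      rcases hchain.total hs ht with h | h
      · exact hc ht x (h hxs) z hzt
      · exact hc hs x hxs z (h hzt)) S hS
  refine ⟨M, hSM, fun x => ⟨fun hx z hz => hM.prop x hx z hz, fun hx => ?_⟩⟩
  have hins : insert x M ∈ {T : Set Plane | ∀ x ∈ T, ∀ z ∈ T, dist x z ≤ 1} := by
    rintro a (rfl | ha) b (rfl | hb)
    · simp
    · exact hx b hb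
    · rw [dist_comm]; exact hx a ha
    · exact hM.prop a ha b hb
  exact hM.le_of_ge hins (subset_insert x M) (mem_insert x M)

/-- At a support point `x` with outer normal `ξ`, on each side of the normal there is a point of
the set at distance `1` from `x`. -/
lemma exists_dist_eq_one (hM : IsDiamComplete M) {x ξ σ : Plane} (hx : x ∈ M) (hξ : ‖ξ‖ = 1)
    (hσ : ‖σ‖ = 1) (hσξ : inner ℝ σ ξ = 0) (hn : ∀ z ∈ M, inner ℝ (z - x) ξ ≤ 0) :
    ∃ q ∈ M, ‖x - q‖ = 1 ∧ 0 ≤ inner ℝ (x - q) σ := by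
  -- With `s = 1 / (n + 1)`, the term `s ^ 2 • ξ` pushes the point out of `M`, so completeness
  -- provides a point of `M` farther than `1`. The larger term `s • σ` decides on which side the
  -- limit of these points lies.
  have key : ∀ n : ℕ, ∃ q ∈ M, 1 < dist (x + ((1 / ((n : ℝ) + 1)) • σ
      + (1 / ((n : ℝ) + 1)) ^ 2 • ξ)) q := by
    intro n
    by_contra! h
    have hs : (0 : ℝ) < 1 / ((n : ℝ) + 1) := by positivity
    have := hn _ ((hM _).2 h)
    rw [add_sub_cancel_left, inner_add_left, inner_smul_left, inner_smul_left, hσξ,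
      real_inner_self_eq_norm_sq, hξ] at this
    simp only [conj_trivial] at this
    nlinarith [pow_pos hs 2]
  choose q hqM hq using key
  obtain ⟨a, haM, φ, hφ, hlim⟩ := hM.isCompact.tendsto_subseq hqM
  have hs : Tendsto (fun n => 1 / ((φ n : ℝ) + 1)) atTop (𝓝 0) :=
    tendsto_one_div_add_atTop_nhds_zero_nat.comp hφ.tendsto_atTop
  have hxa : Tendsto (fun n => x - q (φ n)) atTop (𝓝 (x - a)) := tendsto_const_nhds.sub hlim
  have hle : ‖x - a‖ ≤ 1 := by rw [← dist_eq_norm]; exact hM.dist_le hx haM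
  refine ⟨a, haM, le_antisymm hle ?_, ?_⟩
  · have h1 : Tendsto (fun n => ‖(x - q (φ n)) + ((1 / ((φ n : ℝ) + 1)) • σ
      + (1 / ((φ n : ℝ) + 1)) ^ 2 • ξ)‖) atTop (𝓝 ‖(x - a) + ((0 : ℝ) • σ + (0 : ℝ) ^ 2 • ξ)‖) :=
      (hxa.add ((hs.smul_const σ).add ((hs.pow 2).smul_const ξ))).norm
    have := ge_of_tendsto' h1 (b := 1) fun n => by
      have := (hq (φ n)).le
      rw [dist_eq_norm] at this
      rwa [add_sub_right_comm] at this
    simpa using this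
  · have h1 : Tendsto (fun n => inner ℝ (x - q (φ n)) σ
        + (1 / ((φ n : ℝ) + 1)) * inner ℝ (x - q (φ n)) ξ
        + ((1 / ((φ n : ℝ) + 1)) + (1 / ((φ n : ℝ) + 1)) ^ 3) / 2) atTop
        (𝓝 (inner ℝ (x - a) σ + 0 * inner ℝ (x - a) ξ + (0 + 0 ^ 3) / 2)) :=
      ((hxa.inner tendsto_const_nhds).add (hs.mul (hxa.inner tendsto_const_nhds))).add
        ((hs.add (hs.pow 3)).div_const 2)
    have := ge_of_tendsto' h1 (b := 0) fun n => by
      have h2 := hq (φ n)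
      have h3 := hM.dist_le hx (hqM (φ n))
      have hs : (0 : ℝ) < 1 / ((φ n : ℝ) + 1) := by positivity
      set s := 1 / ((φ n : ℝ) + 1)
      set b := x - q (φ n) with hb
      rw [dist_eq_norm] at h2 h3
      rw [show x + (s • σ + s ^ 2 • ξ) - q (φ n) = b + (s • σ + s ^ 2 • ξ) by rw [hb]; abel] at h2
      have h4 : 1 < ‖b + (s • σ + s ^ 2 • ξ)‖ ^ 2 := by nlinarith
      rw [norm_add_sq_real, norm_add_sq_real, inner_add_right, inner_smul_right, inner_smul_right,
        inner_smul_left, inner_smul_right, hσξ, norm_smul, norm_smul, hσ, hξ] at h4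
      simp only [Real.norm_eq_abs, mul_one, sq_abs, mul_zero, add_zero] at h4
      have h5 : ‖b‖ ^ 2 ≤ 1 := by nlinarith [norm_nonneg b]
      have h6 : 0 < s * (inner ℝ b σ + s * inner ℝ b ξ + (s + s ^ 3) / 2) := by nlinarith
      exact (pos_of_mul_pos_right h6 hs.le).le
    simpa using this

/-- If `(1, 0)` is between the unit vectors `(c, s)` and `(c', -s')`, which are at distance at most
`1`, then it inherits the inequality `N + 2 ⟨w, ·⟩ ≤ 0`. -/
lemma add_two_mul_nonpos_of_cone {c s c' s' a b N : ℝ} (hN : 0 ≤ N) (hc : 0 ≤ c) (hc' : 0 ≤ c')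
    (hs : 0 ≤ s) (hs' : 0 ≤ s') (h1 : c ^ 2 + s ^ 2 = 1) (h2 : c' ^ 2 + s' ^ 2 = 1)
    (h3 : (c - c') ^ 2 + (s + s') ^ 2 ≤ 1) (w1 : N + 2 * (a * c + b * s) ≤ 0)
    (w2 : N + 2 * (a * c' - b * s') ≤ 0) : N + 2 * a ≤ 0 := by
  have c1 : c ≤ 1 := by nlinarith
  have c1' : c' ≤ 1 := by nlinarith
  have p1 : 0 ≤ s' * c := mul_nonneg hs' hc
  have p2 : 0 ≤ s * c' := mul_nonneg hs hc'
  -- With `A = s' * c + s * c'` one has `A • (1, 0) = s' • (c, s) + s • (c', -s')`, and `A ≤ s + s'`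
  -- with `N ≥ 0` absorbs the excess weight. If `A = 0`, then either `(1, 0)` is one of the two
  -- vectors, or they are antipodal, which `h3` forbids.
  rcases (add_nonneg p1 p2).lt_or_eq with hA | hA
  · have m1 := mul_le_mul_of_nonneg_left w1 hs'
    have m2 := mul_le_mul_of_nonneg_left w2 hs
    have m3 : (s' * c + s * c') * N ≤ (s' + s) * N := by
      refine mul_le_mul_of_nonneg_right (add_le_add ?_ ?_) hN
      · exact mul_le_of_le_one_right hs' c1
      · exact mul_le_of_le_one_right hs c1'
    have : (s' * c + s * c') * (N + 2 * a) ≤ 0 := by linarith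
    exact nonpos_of_mul_nonpos_right this hA
  · have z1 : s' * c = 0 := by linarith
    have z2 : s * c' = 0 := by linarith
    rcases mul_eq_zero.1 z1 with h | h
    · have : c' = 1 := by rw [h] at h2; nlinarith
      rw [h, this] at w2
      linarith
    · rcases mul_eq_zero.1 z2 with h' | h'
      · rw [h, h'] at h1; norm_num at h1
      · rw [h, h'] at h3; rw [h] at h1; rw [h'] at h2
        nlinarith [mul_nonneg hs hs']

/-- The point opposite to a support point with outer normal `ξ` belongs to the set. -/
theorem sub_normal_mem (hM : IsDiamComplete M) {x ξ : Plane} (hx : x ∈ M) (hξ : ‖ξ‖ = 1)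
    (hn : ∀ z ∈ M, inner ℝ (z - x) ξ ≤ 0) : x - ξ ∈ M := by
  have hσ : ‖rotQuarter ξ‖ = 1 := by rw [norm_rotQuarter, hξ]
  obtain ⟨q, hq, hq1, hqs⟩ := hM.exists_dist_eq_one hx hξ hσ (inner_rotQuarter_self ξ) hn
  obtain ⟨q', hq', hq1', hqs'⟩ := hM.exists_dist_eq_one (σ := -rotQuarter ξ) hx hξ
    (by rwa [norm_neg]) (by rw [inner_neg_left, inner_rotQuarter_self, neg_zero]) hn
  rw [hM]
  -- On the unit circle about `x`, the point `x - ξ` lies on the short arc between `q` and `q'`. A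
  -- point `z` within `1` of `x`, `q` and `q'` is within `1` of that arc.
  intro z hz
  have hc := hn q hq
  have hc' := hn q' hq'
  have e1 := norm_sq_eq_frame hξ (x - q)
  have e2 := norm_sq_eq_frame hξ (x - q')
  have hqq := hM.dist_le hq' hq
  rw [dist_eq_norm] at hqq
  have e3 := norm_sq_eq_frame hξ (q' - q)
  have hw : ∀ p ∈ M, ‖x - p‖ = 1 →
      ‖z - x‖ ^ 2 + 2 * inner ℝ (z - x) (x - p) ≤ 0 := fun p hp h1 => by
    rw [← norm_add_le_one_iff h1, sub_add_sub_cancel, ← dist_eq_norm]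
    exact hM.dist_le hz hp
  have w1 := hw q hq hq1
  have w2 := hw q' hq' hq1'
  rw [inner_eq_frame hξ] at w1 w2
  have e4 : ‖q' - q‖ ^ 2 ≤ 1 := by nlinarith [norm_nonneg (q' - q)]
  rw [dist_comm, dist_eq_norm, show z - (x - ξ) = (z - x) + ξ by abel, norm_add_le_one_iff hξ]
  have i1 : inner ℝ (q - x) ξ = - inner ℝ (x - q) ξ := by rw [← inner_neg_left, neg_sub]
  have i2 : inner ℝ (q' - x) ξ = - inner ℝ (x - q') ξ := by rw [← inner_neg_left, neg_sub]
  have i3 : inner ℝ (q' - q) ξ = inner ℝ (x - q) ξ - inner ℝ (x - q') ξ := by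
    rw [← inner_sub_left]; congr 1; abel
  have i4 : inner ℝ (q' - q) (rotQuarter ξ)
      = inner ℝ (x - q) (rotQuarter ξ) - inner ℝ (x - q') (rotQuarter ξ) := by
    rw [← inner_sub_left]; congr 1; abel
  rw [inner_neg_right] at hqs'
  rw [hq1] at e1
  rw [hq1'] at e2
  rw [i3, i4] at e3
  rw [i1] at hc
  rw [i2] at hc'
  set c := inner ℝ (x - q) ξ
  set s := inner ℝ (x - q) (rotQuarter ξ)
  set c' := inner ℝ (x - q') ξ
  set s' := inner ℝ (x - q') (rotQuarter ξ)
  set a := inner ℝ (z - x) ξ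
  set b := inner ℝ (z - x) (rotQuarter ξ)
  set N := ‖z - x‖ ^ 2 with hN
  exact add_two_mul_nonpos_of_cone (c' := c') (s' := -s') (by positivity) (by linarith)
    (by linarith) hqs hqs' (by linarith) (by linarith) (by nlinarith) w1 (by linarith)

end IsDiamComplete

/-! ### Support functions and sets of constant width -/

lemma norm_dir (θ : ℝ) : ‖dir θ‖ = 1 := by
  rw [← sq_eq_sq₀ (norm_nonneg _) zero_le_one, norm_sq_plane]; simp [dir]

lemma inner_le_supportFn {Ω : Set Plane} (hb : Bornology.IsBounded Ω) {x : Plane}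
    (hx : x ∈ closure Ω) (ξ : Plane) : inner ℝ x ξ ≤ supportFn Ω ξ := by
  have hbdd : BddAbove ((fun x : Plane => inner ℝ x ξ) '' Ω) := by
    have hK : IsCompact (closure Ω) := hb.isCompact_closure
    exact ((hK.image (f := fun x : Plane => inner ℝ x ξ) (by fun_prop)).bddAbove).mono
      (image_mono subset_closure)
  have : closure Ω ⊆ {x | inner ℝ x ξ ≤ supportFn Ω ξ} :=
    closure_minimal (fun z hz => le_csSup hbdd (mem_image_of_mem _ hz))
      (isClosed_le (by fun_prop) continuous_const)
  exact this hx

lemma supportFn_le {Ω : Set Plane} (hne : Ω.Nonempty) {ξ : Plane} {c : ℝ}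
    (h : ∀ z ∈ Ω, inner ℝ z ξ ≤ c) : supportFn Ω ξ ≤ c :=
  csSup_le (hne.image _) (by rintro _ ⟨z, hz, rfl⟩; exact h z hz)

lemma exists_inner_eq_supportFn {Ω : Set Plane} (hb : Bornology.IsBounded Ω) (hne : Ω.Nonempty)
    (ξ : Plane) : ∃ x ∈ closure Ω, inner ℝ x ξ = supportFn Ω ξ := by
  obtain ⟨x, hx, hmax⟩ := hb.isCompact_closure.exists_isMaxOn hne.closure
    (f := fun x : Plane => inner ℝ x ξ) (by fun_prop)
  exact ⟨x, hx, le_antisymm (inner_le_supportFn hb hx ξ)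
    (supportFn_le hne fun z hz => hmax (subset_closure hz))⟩

namespace ConstantWidthOne

variable {Ω : Set Plane}

lemma dist_le (hΩ : ConstantWidthOne Ω) {x z : Plane} (hx : x ∈ closure Ω) (hz : z ∈ closure Ω) :
    dist x z ≤ 1 := by
  rcases eq_or_ne x z with rfl | hne
  · simp
  have h0 : x - z ≠ 0 := sub_ne_zero.2 hne
  have hpos : 0 < ‖x - z‖ := norm_pos_iff.2 h0
  set ξ := (‖x - z‖)⁻¹ • (x - z) with hξdef
  have hξ : ‖ξ‖ = 1 := norm_smul_inv_norm h0
  have h1 := inner_le_supportFn hΩ.isBounded hx ξ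
  have h2 := inner_le_supportFn hΩ.isBounded hz (-ξ)
  have h3 := hΩ.width_eq ξ hξ
  have h4 : inner ℝ (x - z) ξ = ‖x - z‖ := by
    rw [hξdef, inner_smul_right, real_inner_self_eq_norm_sq]
    field_simp
  rw [inner_neg_right] at h2
  rw [inner_sub_left] at h4
  rw [dist_eq_norm]
  linarith

/-- A point outside lies strictly beyond some supporting line. Since the width is `1`, it is then
farther than `1` from a support point in the opposite direction. -/
theorem isDiamComplete_closure (hΩ : ConstantWidthOne Ω) : IsDiamComplete (closure Ω) := by
  refine fun x => ⟨fun hx z hz => hΩ.dist_le hx hz, fun h => ?_⟩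
  by_contra hx
  obtain ⟨ζ, hζ, hsep⟩ := exists_unit_normal_of_notMem_isClosed isClosed_closure
    hΩ.convex.closure hΩ.nonempty.closure hx
  obtain ⟨p, hp, hpe⟩ := exists_inner_eq_supportFn hΩ.isBounded hΩ.nonempty ζ
  obtain ⟨q, hq, hqe⟩ := exists_inner_eq_supportFn hΩ.isBounded hΩ.nonempty (-ζ)
  have h1 := hΩ.width_eq ζ hζ
  have h2 := hsep p hp
  have h3 := h q hq
  have h4 := real_inner_le_norm (x - q) ζ
  rw [dist_eq_norm] at h3
  rw [inner_neg_right] at hqe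
  rw [inner_sub_left, hζ, mul_one] at h4
  rw [inner_sub_left] at h2
  linarith

/-- An outer normal of `Ω` is an outer normal of its closure. -/
lemma inner_nonpos_of_mem_gaussMap {x ξ z : Plane} (hξ : ξ ∈ gaussMap Ω x) (hz : z ∈ closure Ω) :
    inner ℝ (z - x) ξ ≤ 0 := by
  have : closure Ω ⊆ {z | inner ℝ (z - x) ξ ≤ 0} :=
    closure_minimal (fun z hz => hξ.2 z hz) (isClosed_le (by fun_prop) continuous_const)
  exact this hz

lemma diam_eq_one (hΩ : ConstantWidthOne Ω) : Metric.diam Ω = 1 := by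
  rw [← Metric.diam_closure]
  refine le_antisymm (Metric.diam_le_of_forall_dist_le zero_le_one
    fun x hx y hy => hΩ.dist_le hx hy) ?_
  have hξ := norm_dir 0
  obtain ⟨p, hp, hpe⟩ := exists_inner_eq_supportFn hΩ.isBounded hΩ.nonempty (dir 0)
  have hq := hΩ.isDiamComplete_closure.sub_normal_mem hp hξ fun z hz => by
    have := inner_le_supportFn hΩ.isBounded hz (dir 0)
    rw [inner_sub_left]; linarith
  have := Metric.dist_le_diam_of_mem hΩ.isBounded.closure hp hq
  rwa [dist_eq_norm, sub_sub_cancel, hξ] at this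

end ConstantWidthOne

namespace IsDiamComplete

variable {M : Set Plane}

lemma closure_interior (hM : IsDiamComplete M) (hne : (interior M).Nonempty) :
    closure (interior M) = M := by
  rw [hM.convex.closure_interior_eq_closure_of_nonempty_interior hne, hM.isClosed.closure_eq]

/-- The interior of a diametrically complete set has constant width. -/
theorem constantWidthOne_interior (hM : IsDiamComplete M) (hne : (interior M).Nonempty) :
    ConstantWidthOne (interior M) := by
  have hb : Bornology.IsBounded (interior M) := hM.isBounded.subset interior_subset
  refine ⟨isOpen_interior, hM.convex.interior, hne, hb, fun ξ hξ => ?_⟩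
  obtain ⟨x, hx, hxe⟩ := exists_inner_eq_supportFn hb hne ξ
  have hxM : x ∈ M := hM.closure_interior hne ▸ hx
  have hy : x - ξ ∈ M := hM.sub_normal_mem hxM hξ fun z hz => by
    have := inner_le_supportFn hb ((hM.closure_interior hne).symm ▸ hz : z ∈ closure (interior M)) ξ
    rw [inner_sub_left]; linarith
  have hy' : x - ξ ∈ closure (interior M) := (hM.closure_interior hne).symm ▸ hy
  have h1 := inner_le_supportFn hb hy' (-ξ)
  have h2 : supportFn (interior M) (-ξ) ≤ inner ℝ (x - ξ) (-ξ) := by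
    refine supportFn_le hne fun z hz => ?_
    have h3 := hM.dist_le hxM (interior_subset hz)
    have h4 := real_inner_le_norm (x - z) ξ
    rw [dist_eq_norm] at h3
    rw [hξ, inner_sub_left] at h4
    rw [inner_neg_right, inner_neg_right, inner_sub_left, real_inner_self_eq_norm_sq, hξ]
    linarith
  have h5 := le_antisymm h1 h2
  rw [← h5, ← hxe, inner_neg_right, inner_sub_left, real_inner_self_eq_norm_sq, hξ]
  ring

lemma dist_lt_of_mem_interior (hM : IsDiamComplete M) {p q : Plane} (hp : p ∈ interior M)
    (hq : q ∈ M) : dist p q < 1 := by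
  have : interior M ⊆ interior (Metric.closedBall q 1) :=
    interior_mono fun z hz => Metric.mem_closedBall.2 (hM.dist_le hz hq)
  have h := this hp
  rw [interior_closedBall q one_ne_zero] at h
  exact Metric.mem_ball.1 h

end IsDiamComplete

/-! ### Regularity of the support function -/

lemma inner_dir_dir (a b : ℝ) : inner ℝ (dir a) (dir b) = Real.cos (a - b) := by
  rw [inner_plane, Real.cos_sub]; simp [dir]

lemma dir_add (a t : ℝ) : dir (a + t) = Real.cos t • dir a + Real.sin t • rotQuarter (dir a) := by
  ext i
  fin_cases i <;> simp [dir, rotQuarter, Real.cos_add, Real.sin_add] <;> ring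

lemma norm_dir_sub_dir_le (a b : ℝ) : ‖dir a - dir b‖ ≤ |a - b| := by
  rw [← sq_le_sq₀ (norm_nonneg _) (abs_nonneg _), norm_sub_sq_real, norm_dir, norm_dir,
    inner_dir_dir, sq_abs]
  linarith [Real.one_sub_sq_div_two_le_cos (x := a - b)]

lemma hasDerivAt_inner_dir (v : Plane) (θ : ℝ) :
    HasDerivAt (fun t => inner ℝ v (dir t)) (inner ℝ v (rotQuarter (dir θ))) θ := by
  simp only [inner_plane]
  refine (((Real.hasDerivAt_cos θ).const_mul (v 0)).fun_add
    ((Real.hasDerivAt_sin θ).const_mul (v 1))).congr_deriv ?_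
  simp [dir, rotQuarter]

lemma hasDerivAt_inner_rotQuarter_dir (v : Plane) (θ : ℝ) :
    HasDerivAt (fun t => inner ℝ v (rotQuarter (dir t))) (-inner ℝ v (dir θ)) θ := by
  simp only [inner_plane]
  refine (((Real.hasDerivAt_sin θ).fun_neg.const_mul (v 0)).fun_add
    ((Real.hasDerivAt_cos θ).const_mul (v 1))).congr_deriv ?_
  simp [dir]
  ring

/-- `X` parametrizes the boundary of `M` by the angle of the outer normal. -/
def IsNormalParam (M : Set Plane) (X : ℝ → Plane) : Prop :=
  ∀ θ, X θ ∈ M ∧ ∀ z ∈ M, inner ℝ (z - X θ) (dir θ) ≤ 0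

lemma ConstantWidthOne.exists_isNormalParam {Ω : Set Plane} (hΩ : ConstantWidthOne Ω) :
    ∃ X, IsNormalParam (closure Ω) X := by
  choose X hX hXe using fun θ => exists_inner_eq_supportFn hΩ.isBounded hΩ.nonempty (dir θ)
  refine ⟨X, fun θ => ⟨hX θ, fun z hz => ?_⟩⟩
  have := inner_le_supportFn hΩ.isBounded hz (dir θ)
  rw [inner_sub_left, hXe]
  linarith

namespace IsNormalParam

variable {M : Set Plane} {X : ℝ → Plane}

lemma sub_dir_mem (hX : IsNormalParam M X) (hM : IsDiamComplete M) (θ : ℝ) : X θ - dir θ ∈ M :=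
  hM.sub_normal_mem (hX θ).1 (norm_dir θ) (hX θ).2

/-- Each of `X a`, `X b` is within `1` of the opposite point of the other. Adding the two
inequalities gives `‖D‖² ≤ ⟪D, dir a - dir b⟫` for `D = X a - X b`, and Cauchy–Schwarz concludes. -/
lemma norm_sub_le (hX : IsNormalParam M X) (hM : IsDiamComplete M) (a b : ℝ) :
    ‖X a - X b‖ ≤ ‖dir a - dir b‖ := by
  have key : ∀ a b, ‖X a - X b‖ ^ 2 + 2 * inner ℝ (X a - X b) (dir b) ≤ 0 := fun a b => by
    rw [← norm_add_le_one_iff (norm_dir b)]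
    have := hM.dist_le (hX a).1 (hX.sub_dir_mem hM b)
    rwa [dist_eq_norm, ← sub_add] at this
  have h1 := key a b
  have h2 := key b a
  rw [← neg_sub (X a) (X b), norm_neg, inner_neg_left] at h2
  have h3 := real_inner_le_norm (X a - X b) (dir a - dir b)
  rw [inner_sub_right] at h3
  by_contra! h
  have h4 : 0 < ‖X a - X b‖ := (norm_nonneg _).trans_lt h
  nlinarith

lemma lipschitzWith (hX : IsNormalParam M X) (hM : IsDiamComplete M) : LipschitzWith 1 X :=
  LipschitzWith.of_dist_le_mul fun a b => by
    rw [dist_eq_norm, Real.dist_eq, NNReal.coe_one, one_mul]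
    exact (hX.norm_sub_le hM a b).trans (norm_dir_sub_dir_le a b)

variable {Ω : Set Plane}

lemma supportFn_eq (hX : IsNormalParam (closure Ω) X) (hΩ : ConstantWidthOne Ω) (θ : ℝ) :
    supportFn Ω (dir θ) = inner ℝ (X θ) (dir θ) := by
  refine le_antisymm (supportFn_le hΩ.nonempty fun z hz => ?_)
    (inner_le_supportFn hΩ.isBounded (hX θ).1 _)
  have := (hX θ).2 z (subset_closure hz)
  rw [inner_sub_left] at this
  linarith

/-- The support point `X θ` bounds the support function from below. By constant width, the opposite
point `X θ - dir θ` bounds it from above, and the two bounds differ by `1 - cos (θ - t)`. Hence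
differentiability holds at every angle. -/
lemma hasDerivAt_supportFn (hX : IsNormalParam (closure Ω) X) (hΩ : ConstantWidthOne Ω) (θ : ℝ) :
    HasDerivAt (fun t => supportFn Ω (dir t)) (inner ℝ (X θ) (rotQuarter (dir θ))) θ := by
  have hM := hΩ.isDiamComplete_closure
  have hbound : ∀ t, ‖supportFn Ω (dir t) - inner ℝ (X θ) (dir t)‖ ≤ 1 * ‖‖t - θ‖ ^ 2‖ := by
    intro t
    have h1 := inner_le_supportFn hΩ.isBounded (hX θ).1 (dir t)
    have h2 := inner_le_supportFn hΩ.isBounded (hX.sub_dir_mem hM θ) (-dir t)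
    have h3 := hΩ.width_eq (dir t) (norm_dir t)
    rw [inner_neg_right, inner_sub_left, inner_dir_dir] at h2
    have h4 := Real.one_sub_sq_div_two_le_cos (x := θ - t)
    rw [Real.norm_of_nonneg (by linarith), Real.norm_of_nonneg (by positivity), Real.norm_eq_abs,
      sq_abs]
    nlinarith [sq_nonneg (t - θ)]
  have h0 : HasDerivAt (fun t => supportFn Ω (dir t) - inner ℝ (X θ) (dir t)) 0 θ := by
    have := Asymptotics.IsBigO.hasFDerivAt (𝕜 := ℝ) (x₀ := θ) (n := 2)
      (Asymptotics.IsBigO.of_bound 1 (Eventually.of_forall hbound)) (by norm_num)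
    simpa using this.hasDerivAt
  have := h0.fun_add (hasDerivAt_inner_dir (X θ) θ)
  simpa using this

lemma deriv_supportFn (hX : IsNormalParam (closure Ω) X) (hΩ : ConstantWidthOne Ω) :
    (deriv fun t => supportFn Ω (dir t)) = fun θ => inner ℝ (X θ) (rotQuarter (dir θ)) :=
  funext fun θ => (hX.hasDerivAt_supportFn hΩ θ).deriv

/-- Almost everywhere, the derivative of the normal parametrization is the curvature function
times the unit tangent vector. -/
lemma ae_hasDerivAt_inner (hX : IsNormalParam (closure Ω) X) (hΩ : ConstantWidthOne Ω)
    (v : Plane) : ∀ᵐ θ : ℝ, HasDerivAt (fun t => inner ℝ (X t) v)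
      (curvatureFn Ω θ * inner ℝ v (rotQuarter (dir θ))) θ := by
  have hM := hΩ.isDiamComplete_closure
  filter_upwards [(hX.lipschitzWith hM).ae_differentiableAt (μ := volume)] with θ hθ
  have hrot : DifferentiableAt ℝ (fun t => rotQuarter (dir t)) θ := by
    rw [differentiableAt_piLp]
    intro i
    fin_cases i <;> simp [rotQuarter, dir]
  have hk : DifferentiableAt ℝ (fun t => inner ℝ (X t) (rotQuarter (dir t))) θ := hθ.inner ℝ hrot
  have hk' := hk.hasDerivAt
  -- In the moving frame the normal coordinate of `X` is the support function and the tangential one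
  -- is its derivative. On differentiating, the normal components cancel and the tangential one is
  -- the curvature function.
  have e : (fun t => inner ℝ (X t) v) = fun t => supportFn Ω (dir t) * inner ℝ v (dir t)
      + inner ℝ (X t) (rotQuarter (dir t)) * inner ℝ v (rotQuarter (dir t)) := by
    funext t
    rw [hX.supportFn_eq hΩ, inner_eq_frame (norm_dir t)]
  rw [e]
  refine (((hX.hasDerivAt_supportFn hΩ θ).fun_mul (hasDerivAt_inner_dir v θ)).fun_add
    (hk'.fun_mul (hasDerivAt_inner_rotQuarter_dir v θ))).congr_deriv ?_
  rw [curvatureFn, hX.deriv_supportFn hΩ]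
  ring

/-- Projecting on the direction of `X b - X a` reduces the bound to the fundamental theorem of
calculus for a scalar Lipschitz function, whose derivative is a.e. at most the curvature function in
absolute value. -/
lemma enorm_sub_le_lintegral (hX : IsNormalParam (closure Ω) X) (hΩ : ConstantWidthOne Ω)
    (a b : ℝ) : ‖X b - X a‖ₑ ≤ ∫⁻ s in uIcc a b, ‖curvatureFn Ω s‖ₑ := by
  rcases eq_or_ne (X b) (X a) with h | h
  · simp [h]
  have h0 : X b - X a ≠ 0 := sub_ne_zero.2 h
  have hpos : 0 < ‖X b - X a‖ := norm_pos_iff.2 h0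
  set v := (‖X b - X a‖)⁻¹ • (X b - X a) with hvdef
  have hv : ‖v‖ = 1 := norm_smul_inv_norm h0
  have hD : inner ℝ (X b) v - inner ℝ (X a) v = ‖X b - X a‖ := by
    rw [← inner_sub_left, hvdef, inner_smul_right, real_inner_self_eq_norm_sq]
    field_simp
  have hLip : LipschitzWith 1 fun t => inner ℝ (X t) v := by
    refine LipschitzWith.of_dist_le_mul fun s t => ?_
    have h1 := (hX.lipschitzWith hΩ.isDiamComplete_closure).dist_le_mul s t
    rw [Real.dist_eq, ← inner_sub_left]
    refine (abs_real_inner_le_norm _ _).trans ?_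
    rwa [hv, mul_one, ← dist_eq_norm]
  have hFTC :=
    (hLip.lipschitzOnWith (s := uIcc a b)).absolutelyContinuousOnInterval.integral_deriv_eq_sub
  rw [hD] at hFTC
  have hder : ∀ᵐ θ : ℝ, ‖deriv (fun t => inner ℝ (X t) v) θ‖ₑ ≤ ‖curvatureFn Ω θ‖ₑ := by
    filter_upwards [hX.ae_hasDerivAt_inner hΩ v] with θ hθ
    rw [hθ.deriv, enorm_le_iff_norm_le, norm_mul]
    refine mul_le_of_le_one_right (norm_nonneg _) ?_
    refine (norm_inner_le_norm _ _).trans ?_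
    rw [hv, norm_rotQuarter, norm_dir, one_mul]
  calc ‖X b - X a‖ₑ = ‖∫ x in a..b, deriv (fun t => inner ℝ (X t) v) x‖ₑ := by
        rw [hFTC, enorm_norm]
    _ = ‖∫ x in uIoc a b, deriv (fun t => inner ℝ (X t) v) x‖ₑ := by
        rw [enorm_eq_iff_norm_eq, intervalIntegral.norm_intervalIntegral_eq]
    _ ≤ ∫⁻ x in uIoc a b, ‖deriv (fun t => inner ℝ (X t) v) x‖ₑ :=
        enorm_integral_le_lintegral_enorm _
    _ ≤ ∫⁻ x in uIoc a b, ‖curvatureFn Ω x‖ₑ := lintegral_mono_ae (ae_restrict_of_ae hder)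
    _ ≤ ∫⁻ x in uIcc a b, ‖curvatureFn Ω x‖ₑ := lintegral_mono_set uIoc_subset_uIcc

/-- At a Lebesgue point of the curvature function with value `0`, the normal parametrization has
vanishing derivative. -/
theorem exists_norm_sub_le (hX : IsNormalParam (closure Ω) X) (hΩ : ConstantWidthOne Ω) {θ₀ : ℝ}
    (hθ₀ : HasLebesgueValue (curvatureFn Ω) θ₀ 0) {η : ℝ} (hη : 0 < η) :
    ∃ δ > 0, ∀ t, |t| < δ → ‖X (θ₀ + t) - X θ₀‖ ≤ η * |t| := by
  -- The mean is taken over an interval of length `2 * |t|`, hence the bound `η / 2`.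
  have hη2 : (0 : ENNReal) < ENNReal.ofReal (η / 2) := by simpa using hη
  have hev := (tendsto_order.1 hθ₀).2 _ hη2
  obtain ⟨δ, hδ, hsub⟩ := mem_nhdsGT_iff_exists_Ioo_subset.1 hev
  refine ⟨δ, hδ, fun t ht => ?_⟩
  rcases eq_or_ne t 0 with rfl | ht0
  · simp
  have htpos : 0 < |t| := abs_pos.2 ht0
  have h1 := hsub ⟨htpos, ht⟩
  simp only [mem_ofPred_eq, sub_zero] at h1
  rw [setLAverage_eq, Real.volume_Icc, show θ₀ + |t| - (θ₀ - |t|) = 2 * |t| by ring,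
    ENNReal.div_lt_iff (Or.inl (by simpa using ht0))
      (Or.inl ENNReal.ofReal_ne_top), ← ENNReal.ofReal_mul (by positivity),
    show η / 2 * (2 * |t|) = η * |t| by ring] at h1
  have h2 := hX.enorm_sub_le_lintegral hΩ θ₀ (θ₀ + t)
  have h3 : uIcc θ₀ (θ₀ + t) ⊆ Icc (θ₀ - |t|) (θ₀ + |t|) := by
    have := abs_le.1 (le_refl |t|)
    exact uIcc_subset_Icc ⟨by linarith, by linarith⟩ ⟨by linarith, by linarith⟩
  have h4 := (h2.trans (lintegral_mono_set h3)).trans h1.le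
  rw [← ofReal_norm] at h4
  exact (ENNReal.ofReal_le_ofReal_iff (by positivity)).1 h4

end IsNormalParam

/-! ### Estimates near a point of vanishing curvature radius -/

lemma eq_of_inner_frame {ξ : Plane} (hξ : ‖ξ‖ = 1) {v w : Plane} (h1 : inner ℝ v ξ = inner ℝ w ξ)
    (h2 : inner ℝ v (rotQuarter ξ) = inner ℝ w (rotQuarter ξ)) : v = w := by
  have h := norm_sq_eq_frame hξ (v - w)
  rw [inner_sub_left, inner_sub_left, h1, h2] at h
  have : ‖v - w‖ = 0 := by nlinarith [norm_nonneg (v - w)]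
  exact sub_eq_zero.1 (norm_eq_zero.1 this)

lemma three_quarters_mul_le_sin {s : ℝ} (h0 : 0 < s) (h1 : s ≤ 1) : 3 / 4 * s ≤ Real.sin s := by
  have h := Real.sin_gt_sub_cube h0
  have : s ^ 3 ≤ s := by
    have : s ^ 2 ≤ 1 := by nlinarith
    nlinarith
  linarith

lemma inner_dir_add (v : Plane) (a t : ℝ) : inner ℝ v (dir (a + t))
    = Real.cos t * inner ℝ v (dir a) + Real.sin t * inner ℝ v (rotQuarter (dir a)) := by
  rw [dir_add, inner_add_right, inner_smul_right, inner_smul_right]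

lemma inner_rotQuarter_dir_add_self (a t : ℝ) :
    inner ℝ (dir (a + t)) (rotQuarter (dir a)) = Real.sin t := by
  rw [dir_add, inner_add_left, inner_smul_left, inner_smul_left, inner_self_rotQuarter,
    real_inner_self_eq_norm_sq, norm_rotQuarter, norm_dir]
  simp

lemma tendsto_sqrt_nhdsGT_zero : Tendsto (fun ε : ℝ => √ε) (𝓝[>] 0) (𝓝 0) := by
  have := (Real.continuous_sqrt.tendsto 0).mono_left (nhdsWithin_le_nhds (s := Ioi 0))
  simpa using this

namespace IsNormalParam

variable {M : Set Plane} {X : ℝ → Plane} {θ₀ : ℝ}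

/-- The part of a complete set outside the unit disc about `X θ₀ - (1 + ε) ξ₀` has horizontal
extent `O(s + ε / s)`, if the boundary point moves little as the normal turns by `s`. -/
lemma mul_le_of_one_le_dist (hX : IsNormalParam M X) (hM : IsDiamComplete M) {ε s σ : ℝ}
    (hε : 0 < ε) (hε1 : ε ≤ 1) (hs : 0 < s) (hs1 : s ≤ 1) (hσ : σ = 1 ∨ σ = -1)
    (hXs : ‖X (θ₀ + σ * s) - X θ₀‖ ≤ s / 4) {z : Plane} (hz : z ∈ M)
    (hzy : 1 ≤ dist z (X θ₀ - (1 + ε) • dir θ₀))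
    (hσz : 0 ≤ σ * inner ℝ (z - X θ₀) (rotQuarter (dir θ₀))) :
    σ * inner ℝ (z - X θ₀) (rotQuarter (dir θ₀)) * s ≤ 2 * s ^ 2 + 4 * ε := by
  set ξ := dir θ₀ with hξdef
  have hξ : ‖ξ‖ = 1 := norm_dir θ₀
  set D := X (θ₀ + σ * s) - X θ₀ with hD
  set u := dir (θ₀ + σ * s) - (1 + ε) • ξ - D with hu
  -- `v + u` joins `z` to the point opposite to `X (θ₀ + σ * s)`, so `‖v + u‖ ≤ 1 ≤ ‖v‖` and
  -- therefore `⟪v, u⟫ ≤ 0`. The estimate is this inequality in coordinates.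
  set v := z - (X θ₀ - (1 + ε) • ξ) with hv
  have h1 : ‖v + u‖ ≤ 1 := by
    have := hM.dist_le hz (hX.sub_dir_mem hM (θ₀ + σ * s))
    rw [dist_eq_norm] at this
    rwa [show v + u = z - (X (θ₀ + σ * s) - dir (θ₀ + σ * s)) by rw [hv, hu, hD]; abel]
  rw [dist_eq_norm] at hzy
  have h2 : inner ℝ v u ≤ 0 := by
    have := norm_add_sq_real v u
    nlinarith [norm_nonneg (v + u), sq_nonneg ‖u‖]
  rw [inner_eq_frame hξ] at h2
  have hsinσ : Real.sin (σ * s) = σ * Real.sin s := by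
    rcases hσ with h | h <;> simp [h]
  have hcosσ : Real.cos (σ * s) = Real.cos s := by
    rcases hσ with h | h <;> simp [h]
  have uξ : inner ℝ u ξ = Real.cos s - (1 + ε) - inner ℝ D ξ := by
    rw [hu, inner_sub_left, inner_sub_left, inner_smul_left, real_inner_self_eq_norm_sq, hξ,
      hξdef, inner_dir_dir, add_sub_cancel_left, hcosσ]
    simp
  have ue : inner ℝ u (rotQuarter ξ) = σ * Real.sin s - inner ℝ D (rotQuarter ξ) := by
    rw [hu, inner_sub_left, inner_sub_left, inner_smul_left, inner_self_rotQuarter,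
      hξdef, inner_rotQuarter_dir_add_self, hsinσ]
    simp
  have vξ : inner ℝ v ξ = inner ℝ (z - X θ₀) ξ + (1 + ε) := by
    rw [hv, ← sub_add, inner_add_left, inner_smul_left, real_inner_self_eq_norm_sq, hξ]
    simp
  have ve : inner ℝ v (rotQuarter ξ) = inner ℝ (z - X θ₀) (rotQuarter ξ) := by
    rw [hv, ← sub_add, inner_add_left, inner_smul_left, inner_self_rotQuarter]
    simp
  rw [uξ, ue, vξ, ve] at h2
  have hDξ : inner ℝ D ξ ≤ 0 := (hX θ₀).2 _ (hX _).1
  have hzξ : inner ℝ (z - X θ₀) ξ ≤ 0 := (hX θ₀).2 _ hz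
  have hzξ' : -1 ≤ inner ℝ (z - X θ₀) ξ := by
    have := abs_real_inner_le_norm (z - X θ₀) ξ
    have h3 := hM.dist_le hz (hX θ₀).1
    rw [dist_eq_norm] at h3
    rw [hξ, mul_one] at this
    exact (abs_le.1 (this.trans h3)).1
  have hDe : |inner ℝ D (rotQuarter ξ)| ≤ s / 4 := by
    refine (abs_real_inner_le_norm _ _).trans ?_
    rwa [norm_rotQuarter, hξ, mul_one]
  have hσD : σ * inner ℝ D (rotQuarter ξ) ≤ s / 4 := by
    have := abs_le.1 hDe
    rcases hσ with h | h <;> rw [h] <;> linarith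
  have hsin := three_quarters_mul_le_sin hs hs1
  have hcos := Real.one_sub_sq_div_two_le_cos (x := s)
  set a := inner ℝ (z - X θ₀) (rotQuarter ξ)
  set b := inner ℝ D (rotQuarter ξ)
  set c := inner ℝ (z - X θ₀) ξ
  set d := inner ℝ D ξ
  have e1 : a * (σ * Real.sin s - b) = (σ * a) * (Real.sin s - σ * b) := by
    rcases hσ with h | h <;> rw [h] <;> ring
  have e2 : (σ * a) * (s / 2) ≤ (σ * a) * (Real.sin s - σ * b) :=
    mul_le_mul_of_nonneg_left (by linarith) hσz
  have e3 : (c + (1 + ε)) * ((1 + ε) - Real.cos s + d) ≤ 2 * (s ^ 2 / 2 + ε) := by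
    have : (1 + ε) - Real.cos s + d ≤ s ^ 2 / 2 + ε := by linarith
    calc (c + (1 + ε)) * ((1 + ε) - Real.cos s + d) ≤ (c + (1 + ε)) * (s ^ 2 / 2 + ε) :=
          mul_le_mul_of_nonneg_left this (by linarith)
      _ ≤ 2 * (s ^ 2 / 2 + ε) := mul_le_mul_of_nonneg_right (by linarith) (by positivity)
  linarith

/-- The part of a complete set outside the unit disc about `X θ₀ - (1 + ε) ξ₀` is shallow. -/
lemma depth_le_of_one_le_dist (hX : IsNormalParam M X) (hM : IsDiamComplete M) {ε : ℝ}
    (hε : 0 < ε) {z : Plane} (hz : z ∈ M) (hzy : 1 ≤ dist z (X θ₀ - (1 + ε) • dir θ₀)) :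
    -inner ℝ (z - X θ₀) (dir θ₀) ≤ ε + inner ℝ (z - X θ₀) (rotQuarter (dir θ₀)) ^ 2 := by
  set ξ := dir θ₀ with hξdef
  have hξ : ‖ξ‖ = 1 := norm_dir θ₀
  set v := z - (X θ₀ - (1 + ε) • ξ) with hv
  rw [dist_eq_norm, ← hv] at hzy
  have vξ : inner ℝ v ξ = inner ℝ (z - X θ₀) ξ + (1 + ε) := by
    rw [hv, ← sub_add, inner_add_left, inner_smul_left, real_inner_self_eq_norm_sq, hξ]
    simp
  have ve : inner ℝ v (rotQuarter ξ) = inner ℝ (z - X θ₀) (rotQuarter ξ) := by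
    rw [hv, ← sub_add, inner_add_left, inner_smul_left, inner_self_rotQuarter]
    simp
  have h1 := norm_sq_eq_frame hξ v
  rw [vξ, ve] at h1
  have hzξ' : -1 ≤ inner ℝ (z - X θ₀) ξ := by
    have := abs_real_inner_le_norm (z - X θ₀) ξ
    have h3 := hM.dist_le hz (hX θ₀).1
    rw [dist_eq_norm] at h3
    rw [hξ, mul_one] at this
    exact (abs_le.1 (this.trans h3)).1
  -- Otherwise the normal coordinate `u` of `v` lies in `[0, 1]` and `u + a ^ 2 < 1`, so `‖v‖² = u ^
  -- 2 + a ^ 2 < 1`.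
  by_contra! h
  set a := inner ℝ (z - X θ₀) (rotQuarter ξ)
  set u := inner ℝ (z - X θ₀) ξ + (1 + ε) with hu
  have hu0 : 0 ≤ u := by linarith
  have hu1 : u + a ^ 2 < 1 := by linarith
  have hu2 : u ^ 2 ≤ u := by nlinarith [sq_nonneg a]
  nlinarith

/-- Bound for the horizontal coordinate by the depth. -/
lemma mul_le_of_depth (hX : IsNormalParam M X) {η s σ : ℝ}
    (hs : 0 < s) (hs1 : s ≤ 1) (hσ : σ = 1 ∨ σ = -1)
    (hXs : ‖X (θ₀ + σ * s) - X θ₀‖ ≤ η * s) {z : Plane} (hz : z ∈ M)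
    (hσz : 0 ≤ σ * inner ℝ (z - X θ₀) (rotQuarter (dir θ₀))) :
    σ * inner ℝ (z - X θ₀) (rotQuarter (dir θ₀)) * (3 / 4 * s)
      ≤ -inner ℝ (z - X θ₀) (dir θ₀) + η * s ^ 2 := by
  set ξ := dir θ₀ with hξdef
  have hξ : ‖ξ‖ = 1 := norm_dir θ₀
  set D := X (θ₀ + σ * s) - X θ₀ with hD
  -- `z` lies below the supporting line with normal tilted by `s`, which passes close to `X θ₀`.
  have h1 : inner ℝ (z - X θ₀) (dir (θ₀ + σ * s)) ≤ inner ℝ D (dir (θ₀ + σ * s)) := by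
    have := (hX (θ₀ + σ * s)).2 z hz
    rw [← sub_nonpos, ← inner_sub_left]
    rwa [show z - X θ₀ - D = z - X (θ₀ + σ * s) by rw [hD]; abel]
  have hsinσ : Real.sin (σ * s) = σ * Real.sin s := by
    rcases hσ with h | h <;> simp [h]
  have hcosσ : Real.cos (σ * s) = Real.cos s := by
    rcases hσ with h | h <;> simp [h]
  rw [inner_dir_add, inner_dir_add, hsinσ, hcosσ] at h1
  have hDξ : inner ℝ D ξ ≤ 0 := (hX θ₀).2 _ (hX _).1
  have hzξ : inner ℝ (z - X θ₀) ξ ≤ 0 := (hX θ₀).2 _ hz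
  have hDe : |inner ℝ D (rotQuarter ξ)| ≤ η * s := by
    refine (abs_real_inner_le_norm _ _).trans ?_
    rwa [norm_rotQuarter, hξ, mul_one]
  have hσD : σ * inner ℝ D (rotQuarter ξ) ≤ η * s := by
    have := abs_le.1 hDe
    rcases hσ with h | h <;> rw [h] <;> linarith
  have hsin := three_quarters_mul_le_sin hs hs1
  have hsin' : Real.sin s ≤ s := Real.sin_le hs.le
  have hcos : 0 ≤ Real.cos s := by
    have := Real.one_sub_sq_div_two_le_cos (x := s)
    nlinarith
  have hcos1 := Real.cos_le_one s
  have hη : 0 ≤ η * s := (norm_nonneg _).trans hXs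
  set a := inner ℝ (z - X θ₀) (rotQuarter ξ)
  set b := inner ℝ D (rotQuarter ξ)
  set c := inner ℝ (z - X θ₀) ξ
  set d := inner ℝ D ξ
  have e1 : σ * a * (3 / 4 * s) ≤ σ * a * Real.sin s := mul_le_mul_of_nonneg_left hsin hσz
  have e2 : Real.cos s * d ≤ 0 := mul_nonpos_of_nonneg_of_nonpos hcos hDξ
  have e3 : c ≤ Real.cos s * c := by nlinarith
  have e4 : (σ * b) * Real.sin s ≤ (η * s) * s := by
    calc (σ * b) * Real.sin s ≤ (η * s) * Real.sin s :=
          mul_le_mul_of_nonneg_right hσD (by linarith)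
      _ ≤ (η * s) * s := mul_le_mul_of_nonneg_left hsin' hη
  nlinarith

lemma exists_sign_mul_eq_abs (a : ℝ) : ∃ σ : ℝ, (σ = 1 ∨ σ = -1) ∧ |σ| = 1 ∧ σ * a = |a| := by
  rcases le_total 0 a with h | h
  · exact ⟨1, Or.inl rfl, by norm_num, by rw [abs_of_nonneg h, one_mul]⟩
  · exact ⟨-1, Or.inr rfl, by norm_num, by rw [abs_of_nonpos h]; ring⟩

/-- If the normal parametrization has vanishing derivative at `θ₀`, the part of `M` outside the
unit disc about `X θ₀ - (1 + ε) ξ₀` has width `o(√ε)` and depth `O(ε)`. -/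
theorem eventually_cap_bound (hX : IsNormalParam M X) (hM : IsDiamComplete M)
    (hflat : ∀ η > 0, ∃ δ > 0, ∀ t, |t| < δ → ‖X (θ₀ + t) - X θ₀‖ ≤ η * |t|)
    {ω : ℝ} (hω : 0 < ω) :
    ∀ᶠ ε in 𝓝[>] (0 : ℝ), ∀ z ∈ M, 1 ≤ dist z (X θ₀ - (1 + ε) • dir θ₀) →
      |inner ℝ (z - X θ₀) (rotQuarter (dir θ₀))| ≤ ω * √ε ∧
      -inner ℝ (z - X θ₀) (dir θ₀) ≤ 37 * ε := by
  obtain ⟨δ₁, hδ₁, H₁⟩ := hflat (1 / 4) (by norm_num)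
  -- The tilt `T * √ε` refines the width bound. Here `η * T ^ 2 = 25`, so depth `37 * ε` gives `(3 /
  -- 4) * T * a ≤ 62 * √ε`, which is below `75 * √ε = (3 / 4) * T * ω * √ε`.
  set T := 100 / ω with hT
  have hTpos : 0 < T := by positivity
  set η := ω / (4 * T) with hη
  obtain ⟨δ₂, hδ₂, H₂⟩ := hflat η (by positivity)
  have hsqrt := tendsto_sqrt_nhdsGT_zero
  have hTs : Tendsto (fun ε : ℝ => T * √ε) (𝓝[>] 0) (𝓝 0) := by
    simpa using hsqrt.const_mul T
  filter_upwards [self_mem_nhdsWithin, (tendsto_order.1 hsqrt).2 _ hδ₁,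
    (tendsto_order.1 hsqrt).2 _ one_pos, (tendsto_order.1 hTs).2 _ hδ₂,
    (tendsto_order.1 hTs).2 _ one_pos] with ε hε h1 h2 h3 h4 z hz hzy
  have hε : 0 < ε := hε
  have hs : 0 < √ε := Real.sqrt_pos.2 hε
  have hsq : √ε ^ 2 = ε := Real.sq_sqrt hε.le
  have hε1 : ε ≤ 1 := by nlinarith
  obtain ⟨σ, hσ, hσ1, hσz⟩ := exists_sign_mul_eq_abs (inner ℝ (z - X θ₀) (rotQuarter (dir θ₀)))
  -- A first tilt `√ε` gives the crude width `6 * √ε`, whence depth at most `ε + 36 * ε`.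
  have hA := hX.mul_le_of_one_le_dist hM (θ₀ := θ₀) (s := √ε) hε hε1 hs h2.le hσ (by
    have := H₁ (σ * √ε) (by rwa [abs_mul, hσ1, one_mul, abs_of_pos hs])
    rw [abs_mul, hσ1, one_mul, abs_of_pos hs] at this
    linarith) hz hzy (by rw [hσz]; positivity)
  have hB := hX.depth_le_of_one_le_dist hM hε hz hzy
  have hTs0 : 0 < T * √ε := by positivity
  have hC := hX.mul_le_of_depth (θ₀ := θ₀) (s := T * √ε) (η := η) hTs0 h4.le hσ (by
    have := H₂ (σ * (T * √ε)) (by rwa [abs_mul, hσ1, one_mul, abs_of_pos hTs0])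
    rwa [abs_mul, hσ1, one_mul, abs_of_pos hTs0] at this) hz (by rw [hσz]; positivity)
  rw [hσz] at hA hC
  rw [← sq_abs] at hB
  set a := |inner ℝ (z - X θ₀) (rotQuarter (dir θ₀))|
  have ha : 0 ≤ a := abs_nonneg _
  have ha6 : a ≤ 6 * √ε := by
    rw [hsq] at hA
    by_contra! h
    nlinarith
  have hdepth : -inner ℝ (z - X θ₀) (dir θ₀) ≤ 37 * ε := by nlinarith
  refine ⟨?_, hdepth⟩
  have e1 : a * (3 / 4 * (T * √ε)) ≤ 37 * ε + η * (T * √ε) ^ 2 := by linarith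
  have e2 : a * (3 / 4 * T) ≤ (37 + η * T ^ 2) * √ε := by
    by_contra! h
    have := mul_lt_mul_of_pos_right h hs
    nlinarith
  have e3 : η * T ^ 2 = 25 := by rw [hη, hT]; field_simp; norm_num
  have e4 : T * ω = 100 := by rw [hT]; field_simp
  rw [e3] at e2
  have e5 : T * a ≤ T * (ω * √ε) := by
    rw [← mul_assoc, e4]
    nlinarith
  exact le_of_mul_le_mul_left e5 hTpos

/-- A convex set containing `X θ₀ - (1 + ε) ξ₀` and the part of `M` near it contains a rectangle of
width `√ε / 16` and height `ε / 2`. -/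
theorem eventually_rectangle_subset (hX : IsNormalParam M X) (hM : IsDiamComplete M)
    (hflat : ∀ η > 0, ∃ δ > 0, ∀ t, |t| < δ → ‖X (θ₀ + t) - X θ₀‖ ≤ η * |t|) :
    ∀ᶠ ε in 𝓝[>] (0 : ℝ), ∀ K : Set Plane, Convex ℝ K → X θ₀ - (1 + ε) • dir θ₀ ∈ K →
      M ∩ Metric.ball (X θ₀ - (1 + ε) • dir θ₀) 1 ⊆ K →
      {z | inner ℝ (z - X θ₀) (dir θ₀) ∈ Ioo (-1 - ε / 2) (-1) ∧
        inner ℝ (z - X θ₀) (rotQuarter (dir θ₀)) ∈ Ioo (-(√ε / 16)) 0} ⊆ K := by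
  obtain ⟨δ₁, hδ₁, H₁⟩ := hflat (1 / 4) (by norm_num)
  have hsqrt := tendsto_sqrt_nhdsGT_zero
  filter_upwards [self_mem_nhdsWithin, (tendsto_order.1 hsqrt).2 _ hδ₁,
    (tendsto_order.1 hsqrt).2 (1 / 4) (by norm_num)] with ε hε h1 h2 K hK hyK hMK z hz
  have hε : 0 < ε := hε
  obtain ⟨⟨hb1, hb2⟩, ha1, ha2⟩ := hz
  set t := √ε with ht
  have hs : 0 < t := Real.sqrt_pos.2 hε
  have hsq : t ^ 2 = ε := Real.sq_sqrt hε.le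
  set ξ := dir θ₀ with hξdef
  have hξ : ‖ξ‖ = 1 := norm_dir θ₀
  set y := X θ₀ - (1 + ε) • ξ with hy
  have hp : X θ₀ - ξ ∈ M := hX.sub_dir_mem hM θ₀
  have hpK : X θ₀ - ξ ∈ K := by
    refine hMK ⟨hp, ?_⟩
    rw [Metric.mem_ball, dist_eq_norm, hy,
      show X θ₀ - ξ - (X θ₀ - (1 + ε) • ξ) = ε • ξ by module, norm_smul, hξ, mul_one,
      Real.norm_of_nonneg hε.le]
    nlinarith
  set D := X (θ₀ + t) - X θ₀ with hD
  have hDt : ‖D‖ ≤ t / 4 := by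
    have := H₁ t (by rwa [abs_of_pos hs])
    rw [abs_of_pos hs] at this
    linarith
  -- The rectangle is placed in the triangle with vertices `y`, `X θ₀ - ξ` and `w`. By flatness `w`
  -- is displaced sideways by at least `t / 2`, and it rises above `X θ₀ - ξ` by at most `ε / 2`.
  set w := X (θ₀ + t) - dir (θ₀ + t) with hw
  have hwM : w ∈ M := hX.sub_dir_mem hM _
  have hwK : w ∈ K := by
    refine hMK ⟨hwM, ?_⟩
    rw [Metric.mem_ball, dist_eq_norm,
      show w - y = D - (dir (θ₀ + t) - ξ) + ε • ξ by rw [hw, hy, hD]; module]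
    have n1 := norm_dir_sub_dir_le (θ₀ + t) θ₀
    rw [add_sub_cancel_left, abs_of_pos hs] at n1
    have n2 := norm_add_le (D - (dir (θ₀ + t) - ξ)) (ε • ξ)
    have n3 := _root_.norm_sub_le D (dir (θ₀ + t) - ξ)
    rw [norm_smul, hξ, mul_one, Real.norm_of_nonneg hε.le] at n2
    nlinarith
  have wξ : inner ℝ (w - X θ₀) ξ = inner ℝ D ξ - Real.cos t := by
    rw [show w - X θ₀ = D - dir (θ₀ + t) by rw [hw, hD]; abel, inner_sub_left, hξdef,
      inner_dir_dir, add_sub_cancel_left]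
  have we : inner ℝ (w - X θ₀) (rotQuarter ξ) = inner ℝ D (rotQuarter ξ) - Real.sin t := by
    rw [show w - X θ₀ = D - dir (θ₀ + t) by rw [hw, hD]; abel, inner_sub_left, hξdef,
      inner_rotQuarter_dir_add_self]
  have hDξ : inner ℝ D ξ ≤ 0 := (hX θ₀).2 _ (hX _).1
  have hwξ : -1 ≤ inner ℝ (w - X θ₀) ξ := by
    have := abs_real_inner_le_norm (w - X θ₀) ξ
    have h3 := hM.dist_le hwM (hX θ₀).1
    rw [dist_eq_norm] at h3
    rw [hξ, mul_one] at this
    exact (abs_le.1 (this.trans h3)).1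
  have hDe : |inner ℝ D (rotQuarter ξ)| ≤ t / 4 := by
    refine (abs_real_inner_le_norm _ _).trans ?_
    rwa [norm_rotQuarter, hξ, mul_one]
  have hsin := three_quarters_mul_le_sin hs (by linarith)
  have hcos := Real.one_sub_sq_div_two_le_cos (x := t)
  set W := -inner ℝ (w - X θ₀) (rotQuarter ξ) with hW
  have hWt : t / 2 ≤ W := by
    have := (abs_le.1 hDe).2
    linarith
  set q := 1 + inner ℝ (w - X θ₀) ξ with hq
  have hq0 : 0 ≤ q := by linarith
  have hq1 : q ≤ ε / 2 := by linarith
  set a := inner ℝ (z - X θ₀) (rotQuarter ξ) with ha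
  set b := inner ℝ (z - X θ₀) ξ with hb
  have hWpos : 0 < W := by linarith
  -- `α`, `1 - α - γ`, `γ` are the barycentric coordinates of `z`. The bounds `γ ≤ 1 / 8` and `α ≤ 7
  -- / 8` make the middle one nonnegative.
  set γ := -a / W with hγ
  have hγ0 : 0 ≤ γ := div_nonneg (by linarith) hWpos.le
  have hγ1 : γ ≤ 1 / 8 := by rw [hγ, div_le_iff₀ hWpos]; linarith
  have hγW : γ * W = -a := by rw [hγ]; field_simp
  set α := (γ * q - (b + 1)) / ε with hα
  have hαε : α * ε = γ * q - (b + 1) := by rw [hα]; field_simp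
  have hα0 : 0 ≤ α := div_nonneg (by nlinarith) hε.le
  have hα1 : α ≤ 7 / 8 := by
    rw [hα, div_le_iff₀ hε]
    nlinarith
  have hz : z = α • y + (1 - α - γ) • (X θ₀ - ξ) + γ • w := by
    have hz' : z - X θ₀ = (-(α * (1 + ε)) - (1 - α - γ)) • ξ + γ • (w - X θ₀) := by
      refine eq_of_inner_frame hξ ?_ ?_
      · rw [inner_add_left, inner_smul_left, inner_smul_left, real_inner_self_eq_norm_sq, hξ]
        simp only [conj_trivial]
        rw [← hb, show inner ℝ (w - X θ₀) ξ = q - 1 by rw [hq]; ring]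
        linear_combination hαε
      · rw [inner_add_left, inner_smul_left, inner_smul_left, inner_self_rotQuarter]
        simp only [conj_trivial]
        rw [← ha, show inner ℝ (w - X θ₀) (rotQuarter ξ) = -W by rw [hW]; ring]
        linear_combination hγW
    rw [← sub_add_cancel z (X θ₀), hz', hy]
    module
  rw [hz]
  have := hK.sum_mem (t := Finset.univ) (w := ![α, 1 - α - γ, γ]) (z := ![y, X θ₀ - ξ, w])
    (by intro i _; fin_cases i <;> simp <;> linarith) (by simp [Fin.sum_univ_three]; ring)
    (by intro i _; fin_cases i <;> simp [hyK, hpK, hwK])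
  simpa [Fin.sum_univ_three] using this

end IsNormalParam

/-! ### Areas of rectangles in a rotated frame -/

/-- The linear isometry reading off coordinates in the frame `ξ`, `rotQuarter ξ`. -/
noncomputable def frameIsometry (ξ : Plane) (hξ : ‖ξ‖ = 1) : Plane →ₗᵢ[ℝ] Plane where
  toFun z := !₂[inner ℝ z ξ, inner ℝ z (rotQuarter ξ)]
  map_add' x y := by ext i; fin_cases i <;> simp [inner_add_left]
  map_smul' c x := by ext i; fin_cases i <;> simp [inner_smul_left]
  norm_map' z := by
    rw [← sq_eq_sq₀ (norm_nonneg _) (norm_nonneg _), norm_sq_eq_frame hξ z, norm_sq_plane]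
    simp

lemma volume_rectangle {ξ : Plane} (hξ : ‖ξ‖ = 1) (x : Plane) {I J : Set ℝ}
    (hI : MeasurableSet I) (hJ : MeasurableSet J) :
    volume {z : Plane | inner ℝ (z - x) ξ ∈ I ∧ inner ℝ (z - x) (rotQuarter ξ) ∈ J}
      = volume I * volume J := by
  set L := (frameIsometry ξ hξ).toLinearIsometryEquiv rfl with hL
  have hmp : MeasurePreserving (fun z : Plane => WithLp.ofLp (L (z - x))) volume volume :=
    (EuclideanSpace.volume_preserving_symm_measurableEquiv_toLp (Fin 2)).comp
      (L.measurePreserving.comp (measurePreserving_sub_right volume x))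
  have hS : MeasurableSet (Set.pi univ ![I, J]) :=
    MeasurableSet.univ_pi fun i => by fin_cases i <;> simpa
  have h := hmp.measure_preimage hS.nullMeasurableSet
  rw [volume_pi_pi] at h
  simp only [Fin.prod_univ_two, Matrix.cons_val_zero, Matrix.cons_val_one] at h
  rw [← h]
  congr 1
  ext z
  simp [hL, frameIsometry, Fin.forall_fin_two]

/-! ### The completion of a truncated set of constant width -/

namespace ConstantWidthOne

variable {Ω M : Set Plane} {x₀ y p : Plane}

lemma dist_lt_of_mem (hΩ : ConstantWidthOne Ω) {q : Plane} (hp : p ∈ Ω) (hq : q ∈ closure Ω) :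
    dist p q < 1 :=
  hΩ.isDiamComplete_closure.dist_lt_of_mem_interior
    (interior_maximal subset_closure hΩ.isOpen hp) hq

lemma mem_frontier_of_dist_eq_one (hΩ : ConstantWidthOne Ω) (hp : p ∈ closure Ω)
    (hx₀ : x₀ ∈ closure Ω) (h : dist p x₀ = 1) : p ∈ frontier Ω := by
  rw [hΩ.isOpen.frontier_eq]
  exact ⟨hp, fun hpΩ => (hΩ.dist_lt_of_mem hpΩ hx₀).ne h⟩

/-- A point gained by the completion is at distance at least `1` from a point that is lost. -/
lemma exists_one_le_dist_of_mem_diff (hΩ : ConstantWidthOne Ω) (hM : IsDiamComplete M)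
    (hsub : closure Ω ∩ Metric.ball y 1 ⊆ M) (hp : p ∈ interior M \ Ω) :
    ∃ q ∈ closure Ω, 1 ≤ dist p q ∧ 1 ≤ dist q y := by
  -- `p` lies on or beyond a supporting line of `Ω`, so it is at distance at least `1` from the
  -- opposite point `a - ζ`. That point cannot have been kept, since interior points of `M` are
  -- closer than `1` to all of `M`.
  obtain ⟨ζ, hζ, hsep⟩ := exists_unit_normal_of_notMem hΩ.isOpen hΩ.convex hΩ.nonempty hp.2
  obtain ⟨a, ha, hae⟩ := exists_inner_eq_supportFn hΩ.isBounded hΩ.nonempty ζ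
  have hq : a - ζ ∈ closure Ω := hΩ.isDiamComplete_closure.sub_normal_mem ha hζ fun z hz => by
    have := inner_le_supportFn hΩ.isBounded hz ζ
    rw [inner_sub_left]; linarith
  have h1 : 1 ≤ dist p (a - ζ) := by
    have h2 := hsep a ha
    have h3 := real_inner_le_norm (p - (a - ζ)) ζ
    rw [dist_eq_norm]
    rw [hζ, mul_one, inner_sub_left, inner_sub_left, real_inner_self_eq_norm_sq, hζ] at h3
    rw [inner_sub_left] at h2
    linarith
  refine ⟨a - ζ, hq, h1, ?_⟩
  by_contra! h
  exact absurd (hM.dist_lt_of_mem_interior hp.1 (hsub ⟨hq, h⟩)) (not_lt.2 h1)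

lemma diff_interior_subset (hΩ : ConstantWidthOne Ω) (hsub : closure Ω ∩ Metric.ball y 1 ⊆ M) :
    Ω \ interior M ⊆ {z ∈ closure Ω | 1 ≤ dist z y} := by
  rintro z ⟨hz, hzM⟩
  refine ⟨subset_closure hz, ?_⟩
  by_contra! h
  refine hzM (interior_maximal ?_ (hΩ.isOpen.inter Metric.isOpen_ball) ⟨hz, h⟩)
  exact fun w hw => hsub ⟨subset_closure hw.1, hw.2⟩

/-- If the truncation is concentrated near `x₀`, a boundary point `p` of `Ω` at distance `1` from
`x₀` that is not interior to the completion carries a common normal of both sets. -/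
lemma exists_common_normal (hΩ : ConstantWidthOne Ω) (hM : IsDiamComplete M)
    (hne : (interior M).Nonempty) (hloc : Ω \ interior M ⊆ Metric.ball x₀ (1 / 2))
    (hp : p ∈ closure Ω) (hpx : dist p x₀ = 1) (hpM : p ∉ interior M) :
    ∃ ζ : Plane, ‖ζ‖ = 1 ∧ p + ζ ∈ closure Ω ∧ p + ζ ∈ M := by
  obtain ⟨ζ, hζ, hsep⟩ := exists_unit_normal_of_notMem isOpen_interior hM.convex.interior hne hpM
  rw [hM.closure_interior hne] at hsep
  -- The midpoint of `p` and `z` is within `1 / 2` of `p`, so it avoids the ball about `x₀` where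
  -- points are lost. The normal inequality at the midpoint then doubles to one at `z`.
  have hmid : ∀ z ∈ Ω, p + (1 / 2 : ℝ) • (z - p) ∈ M := by
    intro z hz
    have h1 : p + (1 / 2 : ℝ) • (z - p) ∈ Ω := by
      have := hΩ.convex.add_smul_sub_mem_interior' hp
        (by rwa [hΩ.isOpen.interior_eq] : z ∈ interior Ω) (t := 1 / 2) (by constructor <;> norm_num)
      rwa [hΩ.isOpen.interior_eq] at this
    by_contra h2
    have h3 := hloc ⟨h1, fun h => h2 (interior_subset h)⟩
    have h4 : dist p (p + (1 / 2 : ℝ) • (z - p)) ≤ 1 / 2 := by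
      have := hΩ.dist_le (subset_closure hz) hp
      rw [dist_eq_norm] at this
      rw [dist_self_add_right, norm_smul, Real.norm_of_nonneg (by norm_num)]
      linarith
    have h5 := dist_triangle p (p + (1 / 2 : ℝ) • (z - p)) x₀
    rw [Metric.mem_ball] at h3
    linarith
  have hpM' : p ∈ M := by
    have hsub : Metric.ball p (1 / 2) ∩ Ω ⊆ M := by
      rintro z ⟨hzp, hz⟩
      by_contra h2
      have h3 := hloc ⟨hz, fun h => h2 (interior_subset h)⟩
      have h5 := dist_triangle_left p x₀ z
      rw [Metric.mem_ball] at h3 hzp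
      linarith
    have := Metric.isOpen_ball.inter_closure
      (⟨Metric.mem_ball_self (by norm_num), hp⟩ : p ∈ Metric.ball p (1 / 2) ∩ closure Ω)
    exact hM.isClosed.closure_subset_iff.2 hsub this
  have hζΩ : ζ ∈ gaussMap Ω p := by
    refine ⟨hζ, fun z hz => ?_⟩
    have := hsep _ (hmid z hz)
    rw [add_sub_cancel_left, inner_smul_left] at this
    simp only [conj_trivial] at this
    linarith
  refine ⟨-ζ, by rwa [norm_neg], ?_, ?_⟩
  · rw [← sub_eq_add_neg]
    exact hΩ.isDiamComplete_closure.sub_normal_mem hp hζ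
      fun z hz => inner_nonpos_of_mem_gaussMap hζΩ hz
  · rw [← sub_eq_add_neg]
    exact hM.sub_normal_mem hpM' hζ hsep

lemma mem_closure_interior_diff (hΩ : ConstantWidthOne Ω) (hp : p ∈ frontier Ω)
    (hpM : p ∈ interior M) : p ∈ closure (interior M \ Ω) := by
  by_contra h
  rw [hΩ.isOpen.frontier_eq] at hp
  have hn : (closure (interior M \ Ω))ᶜ ∩ interior M ∈ 𝓝 p :=
    (isClosed_closure.isOpen_compl.inter isOpen_interior).mem_nhds ⟨h, hpM⟩
  refine hp.2 (mem_of_mem_nhds (mem_of_superset hn ?_))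
  rintro z ⟨hz1, hz2⟩
  by_contra hz
  exact hz1 (subset_closure ⟨hz2, hz⟩)

/-- The completion gains area near every point diametral to `x₀`. -/
theorem mem_closure_gain (hΩ : ConstantWidthOne Ω) (hM : IsDiamComplete M)
    (hne : (interior M).Nonempty) (hloc : Ω \ interior M ⊆ Metric.ball x₀ (1 / 2))
    (hx₀ : x₀ ∈ closure Ω) {ξ : Plane} (hξ : ξ ∈ gaussMap Ω x₀) {ε : ℝ} (hε : 0 < ε)
    (hy : x₀ - (1 + ε) • ξ ∈ M) {x₁ : Plane} (hx₁ : x₁ ∈ closure Ω) (h01 : dist x₀ x₁ = 1) :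
    x₁ ∈ closure (interior M \ Ω) := by
  have hC := hΩ.isDiamComplete_closure
  have hξ1 := hξ.1
  have hopp : x₀ - ξ ∈ closure Ω :=
    hC.sub_normal_mem hx₀ hξ1 fun z hz => inner_nonpos_of_mem_gaussMap hξ hz
  obtain ⟨ξ₁, rfl⟩ : ∃ ξ₁, x₁ = x₀ - ξ₁ := ⟨x₀ - x₁, by abel⟩
  have hξ₁ : ‖ξ₁‖ = 1 := by rwa [dist_eq_norm, sub_sub_cancel] at h01
  -- If `x₁` is the opposite point, a common normal `ζ` would need `⟪ξ₁, ζ⟫ < 0` because of `y`, and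
  -- `⟪ξ₁, ζ⟫ ≥ 1 / 2` because of `x₀`.
  rcases eq_or_ne ξ₁ ξ with rfl | hne1
  · have hd : dist (x₀ - ξ₁) x₀ = 1 := by rw [dist_comm, h01]
    refine hΩ.mem_closure_interior_diff (hΩ.mem_frontier_of_dist_eq_one hx₁ hx₀ hd) ?_
    by_contra hpM
    obtain ⟨ζ, hζ, hζΩ, hζM⟩ := hΩ.exists_common_normal hM hne hloc hx₁ hd hpM
    have h1 := hM.dist_le hζM hy
    have h2 := hC.dist_le hζΩ hx₀
    rw [dist_eq_norm, show x₀ - ξ₁ + ζ - (x₀ - (1 + ε) • ξ₁) = ε • ξ₁ + ζ by module,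
      norm_add_le_one_iff hζ, norm_smul, inner_smul_left, hξ₁] at h1
    rw [dist_eq_norm, show x₀ - ξ₁ + ζ - x₀ = -ξ₁ + ζ by abel,
      norm_add_le_one_iff hζ, norm_neg, hξ₁, inner_neg_left] at h2
    simp only [Real.norm_eq_abs, mul_one, sq_abs, conj_trivial] at h1
    nlinarith
  set c := inner ℝ ξ ξ₁ with hc
  have hc2 : 1 / 2 ≤ c := by
    have := hC.dist_le hopp hx₁
    rw [dist_eq_norm, show x₀ - ξ - (x₀ - ξ₁) = -ξ + ξ₁ by abel, norm_add_le_one_iff hξ₁, norm_neg,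
      hξ1, inner_neg_left] at this
    linarith
  have hc1 : c < 1 := (inner_lt_one_iff_real_of_norm_eq_one hξ1 hξ₁).2 hne1.symm
  have hnorm : ∀ s : ℝ, ‖(1 - s) • ξ + s • ξ₁‖ ^ 2 = 1 - 2 * (s * (1 - s)) * (1 - c) := by
    intro s
    rw [norm_add_sq_real, norm_smul, norm_smul, inner_smul_left, inner_smul_right, hξ1, hξ₁, ← hc]
    simp only [Real.norm_eq_abs, mul_one, sq_abs, conj_trivial]
    ring
  -- At `x₁` itself a common normal is not excluded directly, so `x₁` is approached along the open
  -- arc of points `x₀ - u` between `x₀ - ξ` and `x₁`.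
  have key : ∀ s ∈ Ioo (0 : ℝ) 1,
      x₀ - ‖(1 - s) • ξ + s • ξ₁‖⁻¹ • ((1 - s) • ξ + s • ξ₁) ∈ closure (interior M \ Ω) := by
    rintro s ⟨hs0, hs1⟩
    have hN2 := hnorm s
    set v := (1 - s) • ξ + s • ξ₁ with hv
    have hss : 0 < s * (1 - s) := mul_pos hs0 (by linarith)
    have hss' : s * (1 - s) ≤ 1 / 4 := by nlinarith [sq_nonneg (s - 1 / 2)]
    have hv0 : v ≠ 0 := by
      rintro h
      rw [h, norm_zero] at hN2
      nlinarith
    have hN : 0 < ‖v‖ := norm_pos_iff.2 hv0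
    have hN1 : ‖v‖ < 1 := by
      have : 0 < s * (1 - s) * (1 - c) := mul_pos hss (by linarith)
      nlinarith
    set u := ‖v‖⁻¹ • v with hu
    have hu1 : ‖u‖ = 1 := norm_smul_inv_norm hv0
    have hNu : v = ‖v‖ • u := by rw [hu, smul_inv_smul₀ hN.ne']
    have hpΩ : x₀ - u ∈ closure Ω := by
      refine hC.sub_normal_mem hx₀ hu1 fun z hz => ?_
      have h1 := inner_nonpos_of_mem_gaussMap hξ hz
      have h2 : inner ℝ (z - x₀) ξ₁ ≤ 0 := by
        have := hC.dist_le hz hx₁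
        rw [dist_eq_norm, ← sub_add, norm_add_le_one_iff hξ₁] at this
        nlinarith [sq_nonneg ‖z - x₀‖]
      rw [hu, inner_smul_right, hv, inner_add_right, inner_smul_right, inner_smul_right]
      refine mul_nonpos_of_nonneg_of_nonpos (by positivity) ?_
      nlinarith
    have hd : dist (x₀ - u) x₀ = 1 := by
      rw [dist_eq_norm, sub_sub_cancel_left, norm_neg, hu1]
    refine hΩ.mem_closure_interior_diff (hΩ.mem_frontier_of_dist_eq_one hpΩ hx₀ hd) ?_
    by_contra hpM
    obtain ⟨ζ, hζ, hζΩ, hζM⟩ := hΩ.exists_common_normal hM hne hloc hpΩ hd hpM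
    have h1 := hC.dist_le hζΩ hopp
    have h2 := hC.dist_le hζΩ hx₁
    rw [dist_eq_norm, show x₀ - u + ζ - (x₀ - ξ) = (ζ - u) + ξ by abel,
      norm_add_le_one_iff hξ1] at h1
    rw [dist_eq_norm, show x₀ - u + ζ - (x₀ - ξ₁) = (ζ - u) + ξ₁ by abel,
      norm_add_le_one_iff hξ₁] at h2
    have h3 : inner ℝ (ζ - u) v = (1 - s) * inner ℝ (ζ - u) ξ + s * inner ℝ (ζ - u) ξ₁ := by
      rw [hv, inner_add_right, inner_smul_right, inner_smul_right]
    have h4 : inner ℝ (ζ - u) v = ‖v‖ * inner ℝ (ζ - u) u := by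
      conv_lhs => rw [hNu, inner_smul_right]
    have h5 : ‖ζ - u‖ ^ 2 + 2 * inner ℝ (ζ - u) u = 0 := by
      have := norm_add_sq_real (ζ - u) u
      rw [sub_add_cancel, hζ, hu1] at this
      linarith
    -- The distance bounds to the two ends of the arc combine to `‖ζ - u‖² + 2 * ‖v‖ * ⟪ζ - u, u⟫ ≤
    -- 0`. With `h5` and `‖v‖ < 1` this forces `ζ = u`, so `x₀ ∈ M`, although `x₀` is at distance `1
    -- + ε` from `y`.
    have h6 : (1 - ‖v‖) * ‖ζ - u‖ ^ 2 ≤ 0 := by nlinarith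
    have h7 : ‖ζ - u‖ = 0 := by
      have h8 : ‖ζ - u‖ ^ 2 ≤ 0 := nonpos_of_mul_nonpos_right h6 (by linarith)
      nlinarith [norm_nonneg (ζ - u)]
    have h9 : ζ = u := sub_eq_zero.1 (norm_eq_zero.1 h7)
    rw [h9, sub_add_cancel] at hζM
    have h10 := hM.dist_le hζM hy
    rw [dist_eq_norm, sub_sub_cancel, norm_smul, hξ1, mul_one,
      Real.norm_of_nonneg (by linarith)] at h10
    linarith
  have hcont : ContinuousAt
      (fun s : ℝ => x₀ - ‖(1 - s) • ξ + s • ξ₁‖⁻¹ • ((1 - s) • ξ + s • ξ₁)) 1 := by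
    have : ‖(1 - (1 : ℝ)) • ξ + (1 : ℝ) • ξ₁‖ ≠ 0 := by simp [hξ₁]
    have hn : ContinuousAt (fun s : ℝ => ‖(1 - s) • ξ + s • ξ₁‖) 1 := by fun_prop
    exact continuousAt_const.sub ((hn.inv₀ this).smul (by fun_prop))
  have hlim : Tendsto (fun s : ℝ => x₀ - ‖(1 - s) • ξ + s • ξ₁‖⁻¹ • ((1 - s) • ξ + s • ξ₁))
      (𝓝[<] 1) (𝓝 (x₀ - ξ₁)) := by
    have := hcont.tendsto.mono_left (nhdsWithin_le_nhds (s := Iio 1))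
    simpa [hξ₁] using this
  refine isClosed_closure.mem_of_tendsto hlim ?_
  filter_upwards [Ioo_mem_nhdsLT (zero_lt_one (α := ℝ))] with s hs using key s hs

/-- As the centre of the truncating disc tends to the opposite point, the gained part
concentrates at the diametral points. -/
theorem eventually_gain_subset_thickening (hΩ : ConstantWidthOne Ω) (hx₀ : x₀ ∈ frontier Ω)
    {ξ : Plane} (hξ : ξ ∈ gaussMap Ω x₀) {M : ℝ → Set Plane} (hM : ∀ ε, IsDiamComplete (M ε))
    (hy : ∀ ε, x₀ - (1 + ε) • ξ ∈ M ε)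
    (hsub : ∀ ε, closure Ω ∩ Metric.ball (x₀ - (1 + ε) • ξ) 1 ⊆ M ε)
    (hcap : ∀ δ > 0, ∀ᶠ ε in 𝓝[>] (0 : ℝ), ∀ z ∈ closure Ω,
      1 ≤ dist z (x₀ - (1 + ε) • ξ) → dist z x₀ < δ) {δ : ℝ} (hδ : 0 < δ) :
    ∀ᶠ ε in 𝓝[>] (0 : ℝ),
      interior (M ε) \ Ω ⊆ Metric.thickening δ (diametralPoints Ω x₀) := by
  have hC := hΩ.isDiamComplete_closure
  have hx₀C : x₀ ∈ closure Ω := frontier_subset_closure hx₀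
  have hopp : x₀ - ξ ∈ closure Ω :=
    hC.sub_normal_mem hx₀C hξ.1 fun z hz => inner_nonpos_of_mem_gaussMap hξ hz
  by_contra hcon
  rw [not_eventually] at hcon
  have hε1 : ∀ᶠ ε in 𝓝[>] (0 : ℝ), ε ∈ Ioo (0 : ℝ) 1 := Ioo_mem_nhdsGT zero_lt_one
  obtain ⟨e, he, hP⟩ := exists_seq_forall_of_frequently (hcon.and_eventually hε1)
  have hP1 : ∀ n, ∃ p ∈ interior (M (e n)) \ Ω,
      p ∉ Metric.thickening δ (diametralPoints Ω x₀) := fun n => not_subset.1 (hP n).1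
  choose p hp hpt using hP1
  have hpb : ∀ n, p n ∈ Metric.closedBall x₀ 3 := by
    intro n
    have h1 := (hM (e n)).dist_le (interior_subset (hp n).1) (hy (e n))
    have h2 := dist_triangle (p n) (x₀ - (1 + e n) • ξ) x₀
    have h3 : dist (x₀ - (1 + e n) • ξ) x₀ = 1 + e n := by
      rw [dist_eq_norm, sub_sub_cancel_left, norm_neg, norm_smul, hξ.1, mul_one,
        Real.norm_of_nonneg (by linarith [(hP n).2.1])]
    rw [Metric.mem_closedBall]
    linarith [(hP n).2.2]
  obtain ⟨a, -, φ, hφ, hlim⟩ := (isCompact_closedBall x₀ 3).tendsto_subseq hpb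
  have he' : Tendsto (fun n => e (φ n)) atTop (𝓝[>] 0) := he.comp hφ.tendsto_atTop
  have hyl : Tendsto (fun n => x₀ - (1 + e (φ n)) • ξ) atTop (𝓝 (x₀ - ξ)) := by
    have h0 : Tendsto (fun n => e (φ n)) atTop (𝓝 0) := he'.mono_right nhdsWithin_le_nhds
    have : Tendsto (fun n => x₀ - (1 + e (φ n)) • ξ) atTop (𝓝 (x₀ - (1 + (0 : ℝ)) • ξ)) :=
      tendsto_const_nhds.sub ((tendsto_const_nhds.add h0).smul_const ξ)
    simpa using this
  have haΩ : a ∉ Ω := by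
    intro ha
    obtain ⟨n, hn⟩ := (hlim.eventually (hΩ.isOpen.mem_nhds ha)).exists
    exact (hp (φ n)).2 hn
  -- Each `q ∈ Ω` is closer than `1` to `x₀ - ξ`, so it is eventually kept by the truncation and
  -- lies within `1` of the gained points. This bound passes to their limit `a`.
  have haC : a ∈ closure Ω := by
    rw [hC]
    have hΩa : Ω ⊆ Metric.closedBall a 1 := by
      intro q hq
      have h1 : Tendsto (fun n => dist q (x₀ - (1 + e (φ n)) • ξ)) atTop (𝓝 (dist q (x₀ - ξ))) :=
        tendsto_const_nhds.dist hyl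
      have h2 := (tendsto_order.1 h1).2 1 (hΩ.dist_lt_of_mem hq hopp)
      have h3 : Tendsto (fun n => dist q (p (φ n))) atTop (𝓝 (dist q a)) :=
        tendsto_const_nhds.dist hlim
      refine le_of_tendsto h3 ?_
      filter_upwards [h2] with n hn
      exact (hM _).dist_le (hsub _ ⟨subset_closure hq, hn⟩) (interior_subset (hp (φ n)).1)
    intro z hz
    rw [dist_comm]
    exact Metric.isClosed_closedBall.closure_subset_iff.2 hΩa hz
  -- Each gained point is at distance at least `1` from a removed point, and the removed points tend
  -- to `x₀`.
  have hd : dist x₀ a = 1 := by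
    refine le_antisymm (hΩ.dist_le hx₀C haC) ?_
    refine le_of_forall_pos_sub_le fun κ hκ => ?_
    have h3 : Tendsto (fun n => dist x₀ (p (φ n))) atTop (𝓝 (dist x₀ a)) :=
      tendsto_const_nhds.dist hlim
    refine ge_of_tendsto h3 ?_
    filter_upwards [he'.eventually (hcap κ hκ)] with n hn
    obtain ⟨q, hq, hq1, hq2⟩ := hΩ.exists_one_le_dist_of_mem_diff (hM _) (hsub _) (hp (φ n))
    have h4 := hn q hq hq2
    have h5 := dist_triangle_left (p (φ n)) q x₀
    have h6 := dist_comm x₀ q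
    linarith
  have haD : a ∈ diametralPoints Ω x₀ := by
    refine ⟨hx₀, ?_, by rw [hd, hΩ.diam_eq_one]⟩
    rw [hΩ.isOpen.frontier_eq]
    exact ⟨haC, haΩ⟩
  obtain ⟨n, hn⟩ := (hlim.eventually (Metric.ball_mem_nhds a hδ)).exists
  exact hpt (φ n) (Metric.mem_thickening_iff.2 ⟨a, haD, hn⟩)

end ConstantWidthOne

/-! ### Comparison of the lost and the gained area -/

namespace IsNormalParam

variable {Ω : Set Plane} {X : ℝ → Plane} {θ₀ : ℝ}

lemma eventually_cap_dist_lt {C : Set Plane} (hX : IsNormalParam C X) (hC : IsDiamComplete C)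
    (hflat : ∀ η > 0, ∃ δ > 0, ∀ t, |t| < δ → ‖X (θ₀ + t) - X θ₀‖ ≤ η * |t|)
    {δ : ℝ} (hδ : 0 < δ) :
    ∀ᶠ ε in 𝓝[>] (0 : ℝ), ∀ z ∈ C, 1 ≤ dist z (X θ₀ - (1 + ε) • dir θ₀) →
      dist z (X θ₀) < δ := by
  have hlim : Tendsto (fun ε : ℝ => (37 * ε) ^ 2 + √ε ^ 2) (𝓝[>] 0) (𝓝 0) := by
    have h1 : Tendsto (fun ε : ℝ => ε) (𝓝[>] 0) (𝓝 0) := nhdsWithin_le_nhds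
    simpa using ((h1.const_mul 37).pow 2).add (tendsto_sqrt_nhdsGT_zero.pow 2)
  filter_upwards [hX.eventually_cap_bound hC hflat one_pos,
    (tendsto_order.1 hlim).2 (δ ^ 2) (by positivity)] with ε h1 h2 z hz hzy
  obtain ⟨h3, h4⟩ := h1 z hz hzy
  have h5 := (hX θ₀).2 z hz
  have h6 := norm_sq_eq_frame (norm_dir θ₀) (z - X θ₀)
  rw [dist_eq_norm]
  refine lt_of_pow_lt_pow_left₀ 2 hδ.le ?_
  rw [h6]
  have h7 : inner ℝ (z - X θ₀) (dir θ₀) ^ 2 ≤ (37 * ε) ^ 2 := by nlinarith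
  have h8 : inner ℝ (z - X θ₀) (rotQuarter (dir θ₀)) ^ 2 ≤ √ε ^ 2 := by
    rw [one_mul] at h3
    rw [← sq_abs]
    exact pow_le_pow_left₀ (abs_nonneg _) h3 2
  linarith

/-- The lost part lies in a rectangle of height `37 * ε` and width `2 * ω * √ε`. -/
lemma eventually_lost_le (hX : IsNormalParam (closure Ω) X) (hΩ : ConstantWidthOne Ω)
    (hflat : ∀ η > 0, ∃ δ > 0, ∀ t, |t| < δ → ‖X (θ₀ + t) - X θ₀‖ ≤ η * |t|)
    {M : ℝ → Set Plane}
    (hsub : ∀ ε, closure Ω ∩ Metric.ball (X θ₀ - (1 + ε) • dir θ₀) 1 ⊆ M ε)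
    {ω : ℝ} (hω : 0 < ω) :
    ∀ᶠ ε in 𝓝[>] (0 : ℝ), volume.real (Ω \ interior (M ε)) ≤ 74 * ω * (ε * √ε) := by
  filter_upwards [self_mem_nhdsWithin,
    hX.eventually_cap_bound hΩ.isDiamComplete_closure hflat hω] with ε hε h
  have hε : 0 < ε := hε
  have hR := volume_rectangle (norm_dir θ₀) (X θ₀) (measurableSet_Icc (a := -(37 * ε)) (b := 0))
    (measurableSet_Icc (a := -(ω * √ε)) (b := ω * √ε))
  rw [Real.volume_Icc, Real.volume_Icc, ← ENNReal.ofReal_mul (by linarith)] at hR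
  have hss : Ω \ interior (M ε) ⊆ {z : Plane | inner ℝ (z - X θ₀) (dir θ₀) ∈ Icc (-(37 * ε)) 0 ∧
      inner ℝ (z - X θ₀) (rotQuarter (dir θ₀)) ∈ Icc (-(ω * √ε)) (ω * √ε)} := by
    intro z hz
    obtain ⟨hzC, hzy⟩ := hΩ.diff_interior_subset (hsub ε) hz
    obtain ⟨h3, h4⟩ := h z hzC hzy
    exact ⟨⟨by linarith, (hX θ₀).2 z hzC⟩, abs_le.1 h3⟩
  have := ENNReal.toReal_mono (by rw [hR]; exact ENNReal.ofReal_ne_top)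
    (measure_mono (μ := volume) hss)
  rw [hR, ENNReal.toReal_ofReal (by
    have : 0 < ω * √ε := by positivity
    nlinarith)] at this
  calc volume.real (Ω \ interior (M ε)) ≤ _ := this
    _ = 74 * ω * (ε * √ε) := by ring

lemma eventually_le_gain (hX : IsNormalParam (closure Ω) X) (hΩ : ConstantWidthOne Ω)
    (hflat : ∀ η > 0, ∃ δ > 0, ∀ t, |t| < δ → ‖X (θ₀ + t) - X θ₀‖ ≤ η * |t|)
    {M : ℝ → Set Plane} (hM : ∀ ε, IsDiamComplete (M ε))
    (hy : ∀ ε, X θ₀ - (1 + ε) • dir θ₀ ∈ M ε)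
    (hsub : ∀ ε, closure Ω ∩ Metric.ball (X θ₀ - (1 + ε) • dir θ₀) 1 ⊆ M ε) :
    ∀ᶠ ε in 𝓝[>] (0 : ℝ), 1 / 32 * (ε * √ε) ≤ volume.real (interior (M ε) \ Ω) := by
  filter_upwards [self_mem_nhdsWithin,
    hX.eventually_rectangle_subset hΩ.isDiamComplete_closure hflat] with ε hε h
  have hε : 0 < ε := hε
  have hR := volume_rectangle (norm_dir θ₀) (X θ₀)
    (measurableSet_Ioo (a := -1 - ε / 2) (b := -1)) (measurableSet_Ioo (a := -(√ε / 16)) (b := 0))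
  rw [Real.volume_Ioo, Real.volume_Ioo, ← ENNReal.ofReal_mul (by linarith)] at hR
  have hRM := h (M ε) (hM ε).convex (hy ε) (hsub ε)
  have hss : {z : Plane | inner ℝ (z - X θ₀) (dir θ₀) ∈ Ioo (-1 - ε / 2) (-1) ∧
      inner ℝ (z - X θ₀) (rotQuarter (dir θ₀)) ∈ Ioo (-(√ε / 16)) 0} ⊆ interior (M ε) \ Ω := by
    refine subset_sdiff.2 ⟨interior_maximal hRM ?_, ?_⟩
    · exact (isOpen_Ioo.preimage (f := fun z : Plane => inner ℝ (z - X θ₀) (dir θ₀))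
        (by fun_prop)).inter (isOpen_Ioo.preimage
        (f := fun z : Plane => inner ℝ (z - X θ₀) (rotQuarter (dir θ₀))) (by fun_prop))
    -- The rectangle lies at depth more than `1` below `X θ₀`, while `closure Ω` has diameter at
    -- most `1`.
    · rw [Set.disjoint_left]
      rintro z ⟨hz1, -⟩ hzΩ
      have h1 := hΩ.dist_le (subset_closure hzΩ) (hX θ₀).1
      have h2 := abs_real_inner_le_norm (z - X θ₀) (dir θ₀)
      rw [dist_eq_norm] at h1
      rw [norm_dir, mul_one] at h2
      have := (abs_le.1 (h2.trans h1)).1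
      linarith [hz1.2]
  have hfin : volume (interior (M ε) \ Ω) ≠ ⊤ :=
    (((hM ε).isBounded.subset interior_subset).subset sdiff_subset).measure_lt_top.ne
  have := ENNReal.toReal_mono hfin (measure_mono (μ := volume) hss)
  rw [hR, ENNReal.toReal_ofReal (by
    have : 0 < √ε := by positivity
    nlinarith)] at this
  calc 1 / 32 * (ε * √ε) = (-1 - (-1 - ε / 2)) * (0 - -(√ε / 16)) := by ring
    _ ≤ _ := this

end IsNormalParam

lemma isCompact_diametralPoints {Ω : Set Plane} (hb : Bornology.IsBounded Ω) (x : Plane) :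
    IsCompact (diametralPoints Ω x) := by
  refine Metric.isCompact_of_isClosed_isBounded ?_
    (hb.closure.subset fun y hy => frontier_subset_closure hy.2.1)
  by_cases hx : x ∈ frontier Ω
  · have : diametralPoints Ω x = frontier Ω ∩ {y | dist x y = Metric.diam Ω} := by
      ext y; simp [diametralPoints, hx]
    rw [this]
    exact isClosed_frontier.inter (isClosed_eq (by fun_prop) continuous_const)
  · have : diametralPoints Ω x = ∅ := by
      ext y; simp [diametralPoints, hx]
    rw [this]
    exact isClosed_empty

/-- Sets concentrating at the diametral points have vanishing area. -/
lemma tendsto_measureReal_of_subset_thickening {Ω : Set Plane} (hΩ : ConstantWidthOne Ω)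
    (x : Plane) {S : ℝ → Set Plane}
    (hS : ∀ δ > 0, ∀ᶠ ε in 𝓝[>] (0 : ℝ), S ε ⊆ Metric.thickening δ (diametralPoints Ω x)) :
    Tendsto (fun ε => volume.real (S ε)) (𝓝[>] 0) (𝓝 0) := by
  have hK := isCompact_diametralPoints hΩ.isBounded x
  -- The diametral points lie on the boundary of a convex set, which is null. By compactness the
  -- areas of their thickenings tend to this value.
  have h0 : volume (diametralPoints Ω x) = 0 :=
    measure_mono_null (fun y hy => hy.2.1) (hΩ.convex.addHaar_frontier volume)
  have hlim := tendsto_measure_cthickening_of_isCompact (μ := volume) hK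
  rw [h0] at hlim
  have hE : Tendsto (fun ε => volume (S ε)) (𝓝[>] 0) (𝓝 0) := by
    rw [ENNReal.tendsto_nhds_zero]
    intro κ hκ
    have h1 : ∀ᶠ r in 𝓝[>] (0 : ℝ), volume (Metric.cthickening r (diametralPoints Ω x)) < κ :=
      ((tendsto_order.1 hlim).2 κ hκ).filter_mono nhdsWithin_le_nhds
    obtain ⟨r, hr, hr0⟩ := (h1.and self_mem_nhdsWithin).exists
    filter_upwards [hS r hr0] with ε hε
    exact (measure_mono (hε.trans (Metric.thickening_subset_cthickening _ _))).trans hr.le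
  exact (ENNReal.tendsto_toReal ENNReal.zero_ne_top).comp hE

/-! ### The truncated completions and the main theorem -/

/-- A completion of `Ω` truncated by the unit disc about `y`, together with `y`. -/
lemma ConstantWidthOne.exists_truncated_completion {Ω : Set Plane} (hΩ : ConstantWidthOne Ω)
    (y : Plane) : ∃ M, IsDiamComplete M ∧ y ∈ M ∧ closure Ω ∩ Metric.ball y 1 ⊆ M := by
  obtain ⟨M, hSM, hM⟩ := IsDiamComplete.exists_superset
    (S := insert y (closure Ω ∩ Metric.ball y 1)) (by
      rintro a (rfl | ha) b (rfl | hb)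
      · simp
      · rw [dist_comm]; exact (Metric.mem_ball.1 hb.2).le
      · exact (Metric.mem_ball.1 ha.2).le
      · exact hΩ.dist_le ha.1 hb.1)
  exact ⟨M, hM, hSM (mem_insert _ _), (subset_insert _ _).trans hSM⟩

theorem proposition4p3 (Ω : Set Plane) (hΩ : ConstantWidthOne Ω)
    (θ₀ : ℝ) (hθ₀ : HasLebesgueValue (curvatureFn Ω) θ₀ 0)
    (x₀ : Plane) (hx₀ : x₀ ∈ frontier Ω) (hξ₀ : dir θ₀ ∈ gaussMap Ω x₀)
    (x₁ : Plane) (hx₁ : x₁ ∈ diametralPoints Ω x₀) :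
    ∃ (ε₀ : ℝ) (Ωε : ℝ → Set Plane), 0 < ε₀ ∧
      (∀ ε ∈ Ioo 0 ε₀, ConstantWidthOne (Ωε ε) ∧
        x₀ ∈ closure (Ω \ Ωε ε) ∧ x₁ ∈ closure (Ωε ε \ Ω)) ∧
      (∀ δ > 0, ∀ᶠ ε in 𝓝[>] 0,
        Ω \ Ωε ε ⊆ Metric.ball x₀ δ ∧
        Ωε ε \ Ω ⊆ Metric.thickening δ (diametralPoints Ω x₀)) ∧
      Tendsto (fun ε => volume.real (Ω \ Ωε ε)) (𝓝[>] 0) (𝓝 0) ∧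
      Tendsto (fun ε => volume.real (Ωε ε \ Ω)) (𝓝[>] 0) (𝓝 0) ∧
      (∀ ε ∈ Ioo 0 ε₀, 0 < volume.real (Ω \ Ωε ε)) ∧
      Tendsto (fun ε => volume.real (Ωε ε \ Ω) / volume.real (Ω \ Ωε ε)) (𝓝[>] 0) atTop ∧
      (∀ᶠ ε in 𝓝[>] 0, volume.real Ω < volume.real (Ωε ε)) := by
  have hC := hΩ.isDiamComplete_closure
  have hx₀C : x₀ ∈ closure Ω := frontier_subset_closure hx₀
  have hopp : x₀ - dir θ₀ ∈ closure Ω := hC.sub_normal_mem hx₀C hξ₀.1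
    fun z hz => ConstantWidthOne.inner_nonpos_of_mem_gaussMap hξ₀ hz
  -- The value at `θ₀` is overwritten so that the parametrization passes through the given `x₀`.
  obtain ⟨X, hX, hXθ₀⟩ : ∃ X, IsNormalParam (closure Ω) X ∧ X θ₀ = x₀ := by
    obtain ⟨Y, hY⟩ := hΩ.exists_isNormalParam
    refine ⟨Function.update Y θ₀ x₀, fun θ => ?_, Function.update_self ..⟩
    rcases eq_or_ne θ θ₀ with rfl | hθ
    · rw [Function.update_self]
      exact ⟨hx₀C, fun z hz => ConstantWidthOne.inner_nonpos_of_mem_gaussMap hξ₀ hz⟩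
    · rw [Function.update_of_ne hθ]
      exact hY θ
  have hflat : ∀ η > 0, ∃ δ > 0, ∀ t, |t| < δ → ‖X (θ₀ + t) - X θ₀‖ ≤ η * |t| :=
    fun η hη => hX.exists_norm_sub_le hΩ hθ₀ hη
  choose M hM hy hsub using
    fun ε : ℝ => hΩ.exists_truncated_completion (x₀ - (1 + ε) • dir θ₀)
  have hcap : ∀ δ > 0, ∀ᶠ ε in 𝓝[>] (0 : ℝ), ∀ z ∈ closure Ω,
      1 ≤ dist z (x₀ - (1 + ε) • dir θ₀) → dist z x₀ < δ := fun δ hδ => by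
    simpa only [hXθ₀] using hX.eventually_cap_dist_lt hC hflat hδ
  have hlost : ∀ δ > 0, ∀ᶠ ε in 𝓝[>] (0 : ℝ), Ω \ interior (M ε) ⊆ Metric.ball x₀ δ := by
    intro δ hδ
    filter_upwards [hcap δ hδ] with ε hε z hz
    obtain ⟨h1, h2⟩ := hΩ.diff_interior_subset (hsub ε) hz
    exact hε z h1 h2
  have hgain : ∀ δ > 0, ∀ᶠ ε in 𝓝[>] (0 : ℝ),
      interior (M ε) \ Ω ⊆ Metric.thickening δ (diametralPoints Ω x₀) := fun δ hδ =>
    hΩ.eventually_gain_subset_thickening hx₀ hξ₀ hM hy hsub hcap hδ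
  -- Radius `1 / 2` is what the common normal argument needs, and `ε < 1` puts `x₀ - dir θ₀` in the
  -- truncating disc, so that the interior of `M ε` is nonempty.
  obtain ⟨ε₀, hε₀, hε₀sub⟩ := mem_nhdsGT_iff_exists_Ioo_subset.1
    ((hlost (1 / 2) (by norm_num)).and (Ioo_mem_nhdsGT (zero_lt_one (α := ℝ))))
  have hx₀lost : ∀ ε > 0, x₀ ∈ closure (Ω ∩ (M ε)ᶜ) := by
    intro ε hε
    have hx₀M : x₀ ∉ M ε := by
      intro h
      have := (hM ε).dist_le h (hy ε)
      rw [dist_eq_norm, sub_sub_cancel, norm_smul, norm_dir, mul_one,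
        Real.norm_of_nonneg (by linarith)] at this
      linarith
    rw [inter_comm]
    exact (hM ε).isClosed.isOpen_compl.inter_closure ⟨hx₀M, hx₀C⟩
  have hcompl : ∀ ε, Ω ∩ (M ε)ᶜ ⊆ Ω \ interior (M ε) :=
    fun ε z hz => ⟨hz.1, fun h => hz.2 (interior_subset h)⟩
  have hfinΩ : ∀ ε, volume (Ω \ interior (M ε)) ≠ ⊤ :=
    fun ε => (hΩ.isBounded.subset sdiff_subset).measure_lt_top.ne
  have hpos : ∀ ε > 0, 0 < volume.real (Ω \ interior (M ε)) := by
    intro ε hε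
    have hne : (Ω ∩ (M ε)ᶜ).Nonempty := closure_nonempty_iff.1 ⟨x₀, hx₀lost ε hε⟩
    have h1 := (hΩ.isOpen.inter (hM ε).isClosed.isOpen_compl).measure_pos volume hne
    exact ENNReal.toReal_pos (h1.trans_le (measure_mono (hcompl ε))).ne' (hfinΩ ε)
  have hlostA : ∀ ω > 0, ∀ᶠ ε in 𝓝[>] (0 : ℝ),
      volume.real (Ω \ interior (M ε)) ≤ 74 * ω * (ε * √ε) := fun ω hω =>
    hX.eventually_lost_le hΩ hflat (by simpa only [hXθ₀] using hsub) hω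
  have hgainA : ∀ᶠ ε in 𝓝[>] (0 : ℝ), 1 / 32 * (ε * √ε) ≤ volume.real (interior (M ε) \ Ω) :=
    hX.eventually_le_gain hΩ hflat hM (by simpa only [hXθ₀] using hy)
      (by simpa only [hXθ₀] using hsub)
  have hratio : Tendsto (fun ε => volume.real (interior (M ε) \ Ω)
      / volume.real (Ω \ interior (M ε))) (𝓝[>] 0) atTop := by
    rw [tendsto_atTop]
    intro B
    set B' := max B 1 with hB'
    have hB'pos : 0 < B' := lt_of_lt_of_le one_pos (le_max_right _ _)
    -- `2368 = 74 * 32` matches the constants of the two area bounds.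
    filter_upwards [self_mem_nhdsWithin, hgainA, hlostA (1 / (2368 * B')) (by positivity)]
      with ε hε h1 h2
    refine (le_max_left B 1).trans ?_
    rw [le_div_iff₀ (hpos ε hε), ← hB']
    calc B' * volume.real (Ω \ interior (M ε))
        ≤ B' * (74 * (1 / (2368 * B')) * (ε * √ε)) := mul_le_mul_of_nonneg_left h2 hB'pos.le
      _ = 1 / 32 * (ε * √ε) := by field_simp; ring
      _ ≤ _ := h1
  refine ⟨ε₀, fun ε => interior (M ε), hε₀, ?_, fun δ hδ => (hlost δ hδ).and (hgain δ hδ), ?_,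
    tendsto_measureReal_of_subset_thickening hΩ x₀ hgain, fun ε hε => hpos ε hε.1, hratio, ?_⟩
  · intro ε hε
    obtain ⟨hloc, hε1⟩ := hε₀sub hε
    have hne : (interior (M ε)).Nonempty := by
      have hopp' : x₀ - dir θ₀ ∈ Metric.ball (x₀ - (1 + ε) • dir θ₀) 1 := by
        rw [Metric.mem_ball, dist_eq_norm,
          show x₀ - dir θ₀ - (x₀ - (1 + ε) • dir θ₀) = ε • dir θ₀ by module, norm_smul, norm_dir,
          mul_one, Real.norm_of_nonneg hε1.1.le]
        exact hε1.2
      obtain ⟨z, hz1, hz2⟩ := mem_closure_iff.1 hopp _ Metric.isOpen_ball hopp'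
      exact ⟨z, interior_maximal (fun w hw => hsub ε ⟨subset_closure hw.1, hw.2⟩)
        (hΩ.isOpen.inter Metric.isOpen_ball) ⟨hz2, hz1⟩⟩
    refine ⟨(hM ε).constantWidthOne_interior hne, closure_mono (hcompl ε) (hx₀lost ε hε.1), ?_⟩
    exact hΩ.mem_closure_gain (hM ε) hne hloc hx₀C hξ₀ hε.1 (hy ε)
      (frontier_subset_closure hx₁.2.1) (by rw [hx₁.2.2, hΩ.diam_eq_one])
  · have h1 : Tendsto (fun ε : ℝ => 74 * 1 * (ε * √ε)) (𝓝[>] 0) (𝓝 0) := by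
      have h0 : Tendsto (fun ε : ℝ => ε) (𝓝[>] 0) (𝓝 0) := nhdsWithin_le_nhds
      have := (h0.mul tendsto_sqrt_nhdsGT_zero).const_mul (74 * 1)
      rwa [mul_zero, mul_zero] at this
    exact tendsto_of_tendsto_of_tendsto_of_le_of_le' tendsto_const_nhds h1
      (Eventually.of_forall fun ε => measureReal_nonneg) (hlostA 1 one_pos)
  · filter_upwards [self_mem_nhdsWithin, hratio.eventually_gt_atTop 1] with ε hε h1
    rw [one_lt_div (hpos ε hε)] at h1
    have e1 := measureReal_sdiff_add_inter (μ := volume) (s := Ω)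
      (isOpen_interior (s := M ε)).measurableSet hΩ.isBounded.measure_lt_top.ne
    have e2 := measureReal_sdiff_add_inter (μ := volume) (s := interior (M ε))
      hΩ.isOpen.measurableSet ((hM ε).isBounded.subset interior_subset).measure_lt_top.ne
    rw [inter_comm] at e2
    linarith
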